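/- Let $k\ge 3$ and $n_1\ge n_2\ge\dots\ge n_k\ge 1$ be integers, and let $G=K_{n_1,\dots,n_k}$ be the complete $k$-partite graph with partite sets $U_i=\{u_i^1,\dots,u_i^{n_i}\}$, $1\le i\le k$. An edge-coloring of $G$ is a map $c:E(G)\to\mathbb N$; a subgraph is rainbow if its edges have pairwise different colors. Let $\mathrm{ar}(G,K_k)$ be the maximum number of colors in an edge-coloring of $G$ without a rainbow copy of $K_k$; a coloring without rainbow $K_k$ that uses exactly $\mathrm{ar}(G,K_k)$ colors is called extremal. Two edge-colored graphs are isomorphic if there are a graph isomorphism $\rho$ and a bijection $\sigma$ between the sets of colors used such that for every edge $uv$ of color $a$ the edge $\rho(u)\rho(v)$ has color $\sigma(a)$. A book coloring of the book $B_m=K_{m,1,1}$, with vertices $x,y,z_1,\dots,z_m$ and triangles $xyz_i$ ($1\le i\le m$), is a coloring $c$ for which there are distinct colors $a_0,a_1,\dots,a_m$ such that $c(xy)=a_0$ and, for every $i$, the pair $(c(xz_i),c(yz_i))$ is one of $(a_i,a_i)$, $(a_i,a_0)$, $(a_0,a_i)$. Then every extremal coloring of $G$ for $\mathrm{ar}(G,K_k)$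 is isomorphic to a coloring $c$ of $G$ that satisfies one of the following. (1) $k\ge 4$, $n_{k-3}=1$, and any two distinct edges have distinct colors, with the only exception $c(u_{k-3}^1u_{k-2}^1)=c(u_{k-1}^1u_k^1)$. (2) $n_{k-1}=1$, the subgraph induced by $U_{k-2}\cup U_{k-1}\cup U_k$, which is a book $B_{n_{k-2}}$, carries a book coloring, and any two distinct edges of $G$ have distinct colors unless both lie in this book. (3) For every vertex $u_k^s\in U_k$ there are two partite sets $U_i,U_j$ with $1\le i<j<k$ (depending on $s$) and $n_i+n_j=n_{k-2}+n_{k-1}$ such that all edges between $u_k^s$ and $U_i\cup U_j$ have the same color; apart from these coincidences, all edges of $G$ have distinct colors. -/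

import Mathlib

namespace AntiRamsey

open SimpleGraph

/-- The number of colors `|C(G)|` used by an edge-coloring `c : E(G) → ℕ`. -/
noncomputable def numColors {V : Type} {G : SimpleGraph V} (c : G.EdgeLabeling ℕ) : ℕ :=
  (Set.range c).ncard

/-- The colored graph `G` contains a rainbow copy of `H`: a (not necessarily induced) copy of `H`
in `G`, all of whose edges have different colors. -/
def HasRainbow {V W : Type} {G : SimpleGraph V} (c : G.EdgeLabeling ℕ) (H : SimpleGraph W) : Prop :=
  ∃ f : Copy H G, Function.Injective fun e : H.edgeSet => c (f.mapEdgeSet e)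

/-- The anti-Ramsey number `ar(G, H)`. -/
noncomputable def ar {V W : Type} (G : SimpleGraph V) (H : SimpleGraph W) : ℕ :=
  sSup {m | ∃ c : G.EdgeLabeling ℕ, ¬ HasRainbow c H ∧ numColors c = m}

/-- `c` is an extremal coloring for `ar(G, H)`. -/
def IsExtremal {V W : Type} {G : SimpleGraph V} (c : G.EdgeLabeling ℕ) (H : SimpleGraph W) : Prop :=
  ¬ HasRainbow c H ∧ numColors c = ar G H

/-- Isomorphism of edge-colored graphs: a graph isomorphism together with a bijection between the
sets of colors that are used. -/
def ColoredIso {V₁ V₂ : Type} {G₁ : SimpleGraph V₁} {G₂ : SimpleGraph V₂}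
    (c₁ : G₁.EdgeLabeling ℕ) (c₂ : G₂.EdgeLabeling ℕ) : Prop :=
  ∃ (ρ : G₁ ≃g G₂) (σ : Set.range c₁ ≃ Set.range c₂),
    ∀ e : G₁.edgeSet, (σ ⟨c₁ e, Set.mem_range_self e⟩ : ℕ) = c₂ (ρ.mapEdgeSet e)

/-- The complete multipartite graph `K_{n_1,…,n_k}`. The partite set `U_i` consists of the vertices
`⟨i, s⟩` (indices start from `0` in `Fin k`). -/
abbrev multipartite {k : ℕ} (n : Fin k → ℕ) : SimpleGraph (Σ i : Fin k, Fin (n i)) :=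
  completeMultipartiteGraph fun i : Fin k => Fin (n i)

/-- The index that is written `k - j` when the partite sets are numbered `1, …, k`. -/
def fromEnd {k : ℕ} (j : ℕ) (hj : j < k) : Fin k := Fin.rev ⟨j, hj⟩

/-- Vertices of the book: the two vertices `x, y` of the spine and the vertices `z_1, …, z_m`. -/
inductive BookVertex (m : ℕ) : Type
  | x : BookVertex m
  | y : BookVertex m
  | z (i : Fin m) : BookVertex m

/-- The book `B_m = K_{m,1,1}`: the `m` triangles `x y z_i` sharing the edge `x y`. -/
def book (m : ℕ) : SimpleGraph (BookVertex m) where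
  Adj
    | .x, .y => True
    | .y, .x => True
    | .x, .z _ => True
    | .z _, .x => True
    | .y, .z _ => True
    | .z _, .y => True
    | _, _ => False
  symm := ⟨by rintro (_ | _ | _) (_ | _ | _) <;> simp⟩
  loopless := ⟨by rintro (_ | _ | _) <;> simp⟩

/-- The extremal book colorings: with distinct colors `a_0, …, a_m`, the edge `x y` has color
`a_0`, and `(c(x z_i), c(y z_i))` is one of `(a_i, a_i)`, `(a_i, a_0)`, `(a_0, a_i)`. -/
def IsBookColoring {m : ℕ} (c : (book m).EdgeLabeling ℕ) : Prop :=
  ∃ (a₀ : ℕ) (a : Fin m → ℕ), Function.Injective a ∧ (∀ i, a i ≠ a₀) ∧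
    c.get .x .y trivial = a₀ ∧
    ∀ i : Fin m,
      (c.get .x (.z i) trivial = a i ∧ c.get .y (.z i) trivial = a i) ∨
      (c.get .x (.z i) trivial = a i ∧ c.get .y (.z i) trivial = a₀) ∨
      (c.get .x (.z i) trivial = a₀ ∧ c.get .y (.z i) trivial = a i)

section Types

variable {k : ℕ} {n : Fin k → ℕ}

/-- The first vertex of the partite set `U_{k-j}` (in the numbering `1, …, k`). -/
def firstVertex (hpos : ∀ i, 0 < n i) (j : ℕ) (hj : j < k) : Σ i : Fin k, Fin (n i) :=
  ⟨fromEnd j hj, ⟨0, hpos _⟩⟩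

/-- First type: `k ≥ 4`, `n_{k-3} = 1`, and the only two distinct edges of the same color are
`u_{k-3} u_{k-2}` and `u_{k-1} u_k`. -/
def IsType1 (hpos : ∀ i, 0 < n i) (c : (multipartite n).EdgeLabeling ℕ) : Prop :=
  ∃ hk : 4 ≤ k, n (fromEnd 3 (by omega)) = 1 ∧
    ∀ e f : (multipartite n).edgeSet, c e = c f ↔
      e = f ∨
      ((e : Sym2 _) = s(firstVertex hpos 3 (by omega), firstVertex hpos 2 (by omega)) ∧
        (f : Sym2 _) = s(firstVertex hpos 1 (by omega), firstVertex hpos 0 (by omega))) ∨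
      ((f : Sym2 _) = s(firstVertex hpos 3 (by omega), firstVertex hpos 2 (by omega)) ∧
        (e : Sym2 _) = s(firstVertex hpos 1 (by omega), firstVertex hpos 0 (by omega)))

/-- The vertices of the last three partite sets `U_{k-2} ∪ U_{k-1} ∪ U_k`. -/
def lastThree (hk : 3 ≤ k) : Set (Σ i : Fin k, Fin (n i)) :=
  {v | v.1 = fromEnd 2 (by omega) ∨ v.1 = fromEnd 1 (by omega) ∨ v.1 = fromEnd 0 (by omega)}

/-- Second type: `n_{k-1} = 1`, the subgraph induced by the last three partite sets is the book
with `n_{k-2}` triangles, colored by an extremal book coloring, and two distinct edges have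
distinct colors unless they are both in that book. -/
def IsType2 (hk : 3 ≤ k) (c : (multipartite n).EdgeLabeling ℕ) : Prop :=
  n (fromEnd 1 (by omega)) = 1 ∧
  ∃ φ : book (n (fromEnd 2 (by omega))) ↪g multipartite n,
    Set.range φ = lastThree hk ∧
    IsBookColoring (c.pullback φ.toHom) ∧
    ∀ e f : (multipartite n).edgeSet, c e = c f →
      e = f ∨ ((∀ v ∈ (e : Sym2 _), v ∈ Set.range φ) ∧ (∀ v ∈ (f : Sym2 _), v ∈ Set.range φ))

/-- The edges between the vertex `u` and `U_i ∪ U_j`. -/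
def edgesTo (u : Σ i : Fin k, Fin (n i)) (i j : Fin k) : Set (Sym2 (Σ i : Fin k, Fin (n i))) :=
  {e | ∃ v, (v.1 = i ∨ v.1 = j) ∧ e = s(u, v)}

/-- Third type: to every vertex `u` of `U_k` there are assigned two partite sets `U_i, U_j`,
`i < j < k`, with `n_i + n_j = n_{k-2} + n_{k-1}`, such that the edges between `u` and `U_i ∪ U_j`
have the same color; apart from that, all edges have distinct colors. -/
def IsType3 (hk : 3 ≤ k) (c : (multipartite n).EdgeLabeling ℕ) : Prop :=
  ∃ i j : Fin (n (fromEnd 0 (by omega))) → Fin k,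
    (∀ s, i s < j s ∧ j s < fromEnd 0 (by omega) ∧
      n (i s) + n (j s) = n (fromEnd 2 (by omega)) + n (fromEnd 1 (by omega))) ∧
    ∀ e f : (multipartite n).edgeSet, c e = c f ↔
      e = f ∨ ∃ s, (e : Sym2 _) ∈ edgesTo ⟨fromEnd 0 (by omega), s⟩ (i s) (j s) ∧
        (f : Sym2 _) ∈ edgesTo ⟨fromEnd 0 (by omega), s⟩ (i s) (j s)

end Types

end AntiRamsey

/-!
Let `a ≥ b ≥ c` be the sizes of the three smallest parts and `N = c (a + b - 1)`. A transversal,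
one vertex from each part, spans a copy of the complete graph, so a coloring without a rainbow copy
is one for which every transversal `t` spans two edges of the same color.

Choose `t` uniformly at random. For every nonempty set `F` of edges, `N * P(t spans two edges of F)`
is at most `#F - 1`. Summing over the color classes gives `N ≤ ∑ (#F - 1) = |E| - numColors`.
Merging, for every vertex of the smallest part, its edges to the two next smallest parts loses
exactly `N` colors and leaves no rainbow copy, so in an extremal coloring all these inequalities are
equalities: each class attains the bound, and each transversal spans two edges of exactly one class.

If `b ≥ 2`, a class of more than one edge attaining the bound is the full star between a vertex and
two parts, and such stars make up a coloring of the third type. If `b = 1 < a`, it consists of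
edges of one and the same book, and counting transversals class by class gives a book coloring. If
`a = 1`, it is a pair of edges between one-vertex parts, and there is only one such class; this is
the first type if the two edges are disjoint and the third type if they share a vertex.
-/

namespace AntiRamsey

open SimpleGraph
open Finset hiding card
open Fintype (card)
open scoped BigOperators

section Probability

variable {Ω : Type*} [Fintype Ω]

open scoped Classical in
/-- The probability that a uniformly random point of `Ω` satisfies `p`. -/
noncomputable def prob (p : Ω → Prop) : ℚ := 𝔼 ω, if p ω then 1 else 0

variable {p q : Ω → Prop}

theorem prob_nonneg : 0 ≤ prob p := expect_nonneg fun ω _ ↦ by split_ifs <;> simp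

theorem prob_mono (h : ∀ ω, p ω → q ω) : prob p ≤ prob q := by
  classical
  refine expect_le_expect fun ω _ ↦ ?_
  split_ifs with hp hq
  exacts [le_rfl, (hq (h ω hp)).elim, zero_le_one, le_rfl]

theorem prob_eq_zero (h : ∀ ω, ¬ p ω) : prob p = 0 := by simp [prob, h]

theorem eq_of_expect_le {f g : Ω → ℚ} (hfg : ∀ ω, f ω ≤ g ω) (h : 𝔼 ω, g ω ≤ 𝔼 ω, f ω) (ω : Ω) :
    f ω = g ω := by
  by_contra hne
  exact (expect_lt_expect (fun ω _ ↦ hfg ω) ⟨ω, mem_univ _, (hfg ω).lt_of_ne hne⟩).not_ge h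

theorem iff_of_prob_le (h : ∀ ω, p ω → q ω) (hle : prob q ≤ prob p) (ω : Ω) : p ω ↔ q ω := by
  classical
  refine ⟨h ω, fun hq ↦ ?_⟩
  have := eq_of_expect_le (f := fun ω ↦ if p ω then (1 : ℚ) else 0)
    (g := fun ω ↦ if q ω then 1 else 0) (fun ω ↦ by split_ifs <;> grind) (by simpa [prob]) ω
  simpa [hq] using this

theorem prob_le_expect {f : Ω → ℕ} (h : ∀ ω, p ω → 1 ≤ f ω) : prob p ≤ 𝔼 ω, (f ω : ℚ) := by
  refine expect_le_expect fun ω _ ↦ ?_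
  split_ifs with hω
  · exact_mod_cast h ω hω
  · positivity

open scoped Classical in
theorem eq_ite_of_expect_le_prob {f : Ω → ℕ} (h : ∀ ω, p ω → 1 ≤ f ω)
    (hle : 𝔼 ω, (f ω : ℚ) ≤ prob p) (ω : Ω) : f ω = if p ω then 1 else 0 := by
  have := eq_of_expect_le (fun ω ↦ ?_) hle ω
  · exact_mod_cast this.symm
  · split_ifs with hω
    · exact_mod_cast h ω hω
    · positivity

open scoped Classical in
theorem sum_prob {α : Type*} {A : Finset α} {p : α → Ω → Prop} :
    ∑ a ∈ A, prob (p a) = 𝔼 ω, (#{a ∈ A | p a ω} : ℚ) := by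
  simp only [prob, card_filter, Nat.cast_sum, Nat.cast_ite, Nat.cast_one, Nat.cast_zero]
  exact (expect_sum_comm _ _ _).symm

variable [Nonempty Ω]

theorem prob_eq_one (h : ∀ ω, p ω) : prob p = 1 := by simp [prob, h]

theorem prob_le_one : prob p ≤ 1 :=
  (prob_mono fun _ _ ↦ trivial).trans_eq (prob_eq_one fun _ ↦ trivial)

theorem forall_of_one_le_prob (h : 1 ≤ prob p) (ω : Ω) : p ω :=
  (iff_of_prob_le (fun _ _ ↦ trivial) ((prob_eq_one fun _ ↦ trivial).trans_le h) ω).2 trivial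

section UnionBound

variable {α : Type*} {A : Finset α} {p : α → Ω → Prop}

variable (h : ∀ ω, ∃ a ∈ A, p a ω)

include h

theorem one_le_sum_prob : 1 ≤ ∑ a ∈ A, prob (p a) := by
  classical
  rw [sum_prob, ← expect_const (univ_nonempty (α := Ω)) (1 : ℚ)]
  refine expect_le_expect fun ω _ ↦ ?_
  obtain ⟨a, ha, hp⟩ := h ω
  exact_mod_cast one_le_card.2 ⟨a, mem_filter.2 ⟨ha, hp⟩⟩

theorem eq_of_sum_prob_le_one (hle : ∑ a ∈ A, prob (p a) ≤ 1) {ω : Ω} {a b : α} (ha : a ∈ A)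
    (hb : b ∈ A) (hpa : p a ω) (hpb : p b ω) : a = b := by
  classical
  rw [sum_prob, ← expect_const (univ_nonempty (α := Ω)) (1 : ℚ)] at hle
  have hone : (1 : ℚ) = #{a ∈ A | p a ω} := eq_of_expect_le (fun ω ↦ by
    obtain ⟨a, ha, hp⟩ := h ω
    exact_mod_cast one_le_card.2 ⟨a, mem_filter.2 ⟨ha, hp⟩⟩) hle ω
  exact card_le_one.1 (mod_cast hone.ge) a (mem_filter.2 ⟨ha, hpa⟩) b (mem_filter.2 ⟨hb, hpb⟩)

end UnionBound

end Probability

section Transversals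

variable {ι : Type*} {V : ι → Type*}

/-- A set of edges joining vertices of different partite sets. -/
def Crossing (F : Finset (Sym2 (Σ i, V i))) : Prop := ∀ ⦃v w⦄, s(v, w) ∈ F → v.1 ≠ w.1

/-- Both ends of the edge `e` lie on the transversal `t`. -/
def Spans (t : ∀ i, V i) (e : Sym2 (Σ i, V i)) : Prop := ∀ v ∈ e, t v.1 = v.2

open scoped Classical in
/-- The number of vertices of `S` on the transversal `t`. -/
noncomputable def vcount (S : Finset (Σ i, V i)) (t : ∀ i, V i) : ℕ := #{v ∈ S | t v.1 = v.2}

open scoped Classical in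
/-- The number of edges of `F` spanned by the transversal `t`. -/
noncomputable def ecount (F : Finset (Sym2 (Σ i, V i))) (t : ∀ i, V i) : ℕ := #{e ∈ F | Spans t e}

variable {S : Finset (Σ i, V i)} {F : Finset (Sym2 (Σ i, V i))} {t : ∀ i, V i} {v w : Σ i, V i}

@[simp]
theorem spans_mk : Spans t s(v, w) ↔ t v.1 = v.2 ∧ t w.1 = w.2 := by simp [Spans]

theorem one_le_vcount : 1 ≤ vcount S t ↔ ∃ v ∈ S, t v.1 = v.2 := by
  simp [vcount, Finset.one_le_card, Finset.Nonempty]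

theorem one_le_ecount : 1 ≤ ecount F t ↔ ∃ e ∈ F, Spans t e := by
  simp [ecount, Finset.one_le_card, Finset.Nonempty]

theorem two_le_ecount : 2 ≤ ecount F t ↔ ∃ e ∈ F, ∃ f ∈ F, e ≠ f ∧ Spans t e ∧ Spans t f := by
  classical
  refine (Finset.one_lt_card (s := {e ∈ F | Spans t e})).trans ?_
  simp only [mem_filter]
  grind

theorem ecount_le_card : ecount F t ≤ #F := by
  classical exact card_filter_le _ _

theorem vcount_le_one {i : ι} (hS : ∀ v ∈ S, v.1 = i) : vcount S t ≤ 1 := by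
  classical
  refine Finset.card_le_one.2 fun v hv w hw ↦ ?_
  rw [mem_filter] at hv hw
  obtain ⟨i, x⟩ := v
  obtain ⟨j, y⟩ := w
  obtain rfl : i = j := (hS _ hv.1).trans (hS _ hw.1).symm
  exact congrArg _ (hv.2.symm.trans hw.2)

theorem vcount_filter_add (S : Finset (Σ i, V i)) (p : (Σ i, V i) → Prop) [DecidablePred p]
    (t : ∀ i, V i) : vcount {v ∈ S | p v} t + vcount {v ∈ S | ¬ p v} t = vcount S t := by
  classical
  simp only [vcount, filter_filter, and_comm (a := p _), and_comm (a := ¬ p _)]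
  simp only [← filter_filter, card_filter_add_card_filter_not]

theorem exists_transversal_of_ne [∀ i, Nonempty (V i)] (h : v.1 ≠ w.1) :
    ∃ t : ∀ i, V i, t v.1 = v.2 ∧ t w.1 = w.2 := by
  classical
  exact ⟨Function.update (Function.update (fun _ ↦ Classical.arbitrary _) v.1 v.2) w.1 w.2,
    by simp [h]⟩

variable [DecidableEq ι]

open scoped Classical in
theorem vcount_update (S : Finset (Σ i, V i)) (i : ι) (x : V i) (t : ∀ i, V i) :
    vcount S (Function.update t i x) =
      (if ⟨i, x⟩ ∈ S then 1 else 0) + vcount {v ∈ S | v.1 ≠ i} t := by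
  rw [← vcount_filter_add S (·.1 = i)]
  congr 1
  · split_ifs with h
    · refine card_eq_one.2 ⟨⟨i, x⟩, ?_⟩
      ext ⟨j, y⟩
      by_cases hj : j = i
      · subst hj
        simp only [mem_filter, and_true, Function.update_self, mem_singleton, Sigma.mk.injEq,
          heq_eq_eq, true_and]
        grind
      · simp [hj]
    · refine card_eq_zero.2 (filter_eq_empty_iff.2 ?_)
      rintro ⟨j, y⟩ hv
      obtain ⟨hvS, hj⟩ := mem_filter.1 hv
      subst hj
      rw [Function.update_self]
      exact fun hxy ↦ h (hxy ▸ hvS)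
  · refine congrArg Finset.card (filter_congr fun v hv ↦ ?_)
    rw [Function.update_of_ne (mem_filter.1 hv).2]

variable [Fintype ι] [∀ i, Fintype (V i)]

theorem expect_ecount (F : Finset (Sym2 (Σ i, V i))) :
    𝔼 t, (ecount F t : ℚ) = ∑ e ∈ F, prob fun t ↦ Spans t e := by
  simp only [ecount, card_filter, Nat.cast_sum, Nat.cast_ite, Nat.cast_one, Nat.cast_zero,
    expect_sum_comm, prob]

variable [∀ i, Nonempty (V i)]

theorem expect_update (i : ι) (f : (∀ i, V i) → ℚ) :
    𝔼 x, 𝔼 t, f (Function.update t i x) = 𝔼 t, f t := by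
  let e : V i × (∀ i, V i) → V i × (∀ i, V i) := fun p ↦ (p.2 i, Function.update p.2 i p.1)
  have he : Function.Involutive e := fun p ↦ by simp [e]
  calc 𝔼 x, 𝔼 t, f (Function.update t i x)
      = 𝔼 p : V i × (∀ i, V i), f (e p).2 := (expect_product univ univ fun p ↦ f (e p).2).symm
    _ = 𝔼 p : V i × (∀ i, V i), f p.2 := Fintype.expect_equiv he.toPerm _ _ fun _ ↦ rfl
    _ = 𝔼 _x : V i, 𝔼 t, f t := expect_product univ univ fun p ↦ f p.2
    _ = 𝔼 t, f t := Fintype.expect_const _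

theorem prob_eq_expect_prob_update (i : ι) (p : (∀ i, V i) → Prop) :
    prob p = 𝔼 x, prob fun t ↦ p (Function.update t i x) := (expect_update i _).symm

theorem prob_apply_eq (v : Σ i, V i) :
    prob (fun t : ∀ i, V i ↦ t v.1 = v.2) = (card (V v.1) : ℚ)⁻¹ := by
  classical
  rw [prob_eq_expect_prob_update v.1]
  simp only [Function.update_self]
  simp only [prob, Fintype.expect_const]
  rw [Fintype.expect_ite_eq', NNRat.smul_def, mul_one, NNRat.cast_inv, NNRat.cast_natCast]

theorem prob_spans (h : v.1 ≠ w.1) :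
    prob (fun t ↦ Spans t s(v, w)) = ((card (V v.1) * card (V w.1) : ℕ) : ℚ)⁻¹ := by
  classical
  rw [prob_eq_expect_prob_update v.1]
  simp only [spans_mk, Function.update_self,
    Function.update_of_ne h.symm]
  have hx (x : V v.1) : prob (fun t : ∀ i, V i ↦ x = v.2 ∧ t w.1 = w.2) =
      if x = v.2 then (card (V w.1) : ℚ)⁻¹ else 0 := by
    split_ifs with hx
    · simp only [hx, true_and, prob_apply_eq]
    · exact prob_eq_zero fun t ht ↦ hx ht.1
  simp only [hx]
  rw [Fintype.expect_ite_eq', NNRat.smul_def, NNRat.cast_inv, NNRat.cast_natCast, Nat.cast_mul,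
    mul_inv]

theorem expect_vcount (S : Finset (Σ i, V i)) :
    𝔼 t, (vcount S t : ℚ) = ∑ v ∈ S, (card (V v.1) : ℚ)⁻¹ := by
  simp only [vcount, card_filter, Nat.cast_sum, Nat.cast_ite, Nat.cast_one, Nat.cast_zero,
    expect_sum_comm, ← prob_apply_eq, prob]

theorem mul_expect_vcount_le {m : ℕ} (hm : ∀ v ∈ S, m ≤ card (V v.1)) :
    m * 𝔼 t, (vcount S t : ℚ) ≤ #S := by
  rw [expect_vcount, mul_sum, card_eq_sum_ones, Nat.cast_sum, Nat.cast_one]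
  refine sum_le_sum fun v hv ↦ mul_inv_le_one_of_le₀ (mod_cast hm v hv) (by positivity)

theorem mul_expect_ecount_le (hF : Crossing F) {m : ℕ}
    (hm : ∀ v w, s(v, w) ∈ F → m ≤ card (V v.1) * card (V w.1)) :
    m * 𝔼 t, (ecount F t : ℚ) ≤ #F := by
  rw [expect_ecount, mul_sum, card_eq_sum_ones, Nat.cast_sum, Nat.cast_one]
  refine sum_le_sum fun e ↦ e.ind fun v w he ↦ ?_
  rw [prob_spans (hF he)]
  exact mul_inv_le_one_of_le₀ (mod_cast hm v w he) (by positivity)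

end Transversals

section VertexBound

variable {ι : Type*} {V : ι → Type*} [∀ i, Fintype (V i)]

/-- The partite set with index `j`, as a set of vertices. -/
def part (j : ι) : Finset (Σ i, V i) := univ.map (.sigmaMk j)

@[simp]
theorem mem_part {j : ι} {v : Σ i, V i} : v ∈ part j ↔ v.1 = j := by
  simp only [part, mem_map, mem_univ, true_and, Function.Embedding.sigmaMk_apply]
  exact ⟨fun ⟨_, h⟩ ↦ h ▸ rfl, fun h ↦ h ▸ ⟨v.2, rfl⟩⟩

@[simp]
theorem card_part (j : ι) : #(part j : Finset (Σ i, V i)) = card (V j) := by simp [part]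

variable [DecidableEq ι] {S O : Finset (Σ i, V i)}

theorem filter_fst_eq_subset_part (S : Finset (Σ i, V i)) (i : ι) : {v ∈ S | v.1 = i} ⊆ part i :=
  fun _ hv ↦ mem_part.2 (mem_filter.1 hv).2

theorem card_filter_fst_eq_le (S : Finset (Σ i, V i)) (i : ι) :
    #{v ∈ S | v.1 = i} ≤ card (V i) :=
  (card_le_card (filter_fst_eq_subset_part S i)).trans_eq (card_part i)

open scoped Classical in
theorem card_filter_mk_mem (S : Finset (Σ i, V i)) (i : ι) :
    #{x : V i | ⟨i, x⟩ ∈ S} = #{v ∈ S | v.1 = i} := by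
  rw [← card_map (.sigmaMk i)]
  congr 1
  ext ⟨j, y⟩
  simp only [mem_map, mem_filter, mem_univ, true_and, Function.Embedding.sigmaMk_apply]
  constructor
  · rintro ⟨x, hx, h⟩
    exact ⟨h ▸ hx, (congrArg Sigma.fst h).symm⟩
  · rintro ⟨hS, rfl⟩
    exact ⟨y, hS, rfl⟩

variable [Fintype ι]

theorem prob_two_le_vcount_eq_zero {i : ι} (hS : ∀ v ∈ S, v.1 = i) :
    prob (fun t ↦ 2 ≤ vcount S t) = 0 :=
  prob_eq_zero fun t ht ↦ by have := vcount_le_one hS (t := t); omega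

variable [∀ i, Nonempty (V i)]

theorem card_mul_prob_two_le_vcount (S : Finset (Σ i, V i)) (i : ι) :
    card (V i) * prob (fun t ↦ 2 ≤ vcount S t) =
      #{v ∈ S | v.1 = i} * prob (fun t ↦ 1 ≤ vcount {v ∈ S | v.1 ≠ i} t) +
        (card (V i) - #{v ∈ S | v.1 = i}) * prob fun t ↦ 2 ≤ vcount {v ∈ S | v.1 ≠ i} t := by
  classical
  have hx (x : V i) : prob (fun t ↦ 2 ≤ vcount S (Function.update t i x)) =
      if ⟨i, x⟩ ∈ S then prob fun t ↦ 1 ≤ vcount {v ∈ S | v.1 ≠ i} t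
        else prob fun t ↦ 2 ≤ vcount {v ∈ S | v.1 ≠ i} t := by
    simp only [vcount_update]
    split_ifs
    · exact congrArg prob (funext fun t ↦ propext (by omega))
    · simp only [zero_add]
  have hcompl : (#{x : V i | ⟨i, x⟩ ∉ S} : ℚ) = card (V i) - #{v ∈ S | v.1 = i} := by
    rw [← card_filter_mk_mem, eq_sub_iff_add_eq', ← card_univ]
    exact_mod_cast card_filter_add_card_filter_not _
  rw [prob_eq_expect_prob_update i, Fintype.card_mul_expect]
  simp only [hx]
  rw [sum_ite, sum_const, sum_const, card_filter_mk_mem, nsmul_eq_mul, nsmul_eq_mul, hcompl]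

theorem mul_prob_one_le_vcount_le {m : ℕ} (hm : ∀ v ∈ O, m ≤ card (V v.1)) :
    m * prob (fun t ↦ 1 ≤ vcount O t) ≤ #O :=
  (mul_le_mul_of_nonneg_left (prob_le_expect fun _ ↦ id) m.cast_nonneg).trans
    (mul_expect_vcount_le hm)

theorem prob_one_le_vcount_mul_le {m M : ℕ} (hm : 1 ≤ m) (hO : O.Nonempty)
    (hM : ∀ v ∈ O, M ≤ m + card (V v.1)) :
    prob (fun t ↦ 1 ≤ vcount O t) * (M - 1) ≤ #O + m - 1 := by
  have : (1 : ℚ) ≤ m := mod_cast hm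
  have : (1 : ℚ) ≤ #O := mod_cast hO.card_pos
  have h0 : 0 ≤ prob fun t ↦ 1 ≤ vcount O t := prob_nonneg
  have h1 : (prob fun t ↦ 1 ≤ vcount O t) ≤ 1 := prob_le_one
  rcases le_or_gt M (#O + m) with h | h
  · have : (M : ℚ) ≤ #O + m := mod_cast h
    nlinarith
  · obtain ⟨d, rfl⟩ : ∃ d, M = m + d := ⟨M - m, by omega⟩
    have : (#O : ℚ) < d := by exact_mod_cast (by omega : #O < d)
    have hP := mul_prob_one_le_vcount_le (m := d) fun v hv ↦ by have := hM v hv; omega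
    push_cast
    nlinarith

theorem eq_part_of_prob_one_le_vcount_mul_eq {m M : ℕ} (hm : 2 ≤ m) (hO : O.Nonempty)
    (hM : ∀ v ∈ O, M ≤ m + card (V v.1))
    (heq : prob (fun t ↦ 1 ≤ vcount O t) * (M - 1) = #O + m - 1) :
    ∃ j, O = part j ∧ m + card (V j) = M := by
  have : (2 : ℚ) ≤ m := mod_cast hm
  have : (1 : ℚ) ≤ #O := mod_cast hO.card_pos
  have h0 : 0 ≤ prob fun t ↦ 1 ≤ vcount O t := prob_nonneg
  have h1 : (prob fun t ↦ 1 ≤ vcount O t) ≤ 1 := prob_le_one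
  have hMO : M = m + #O := by
    rcases lt_trichotomy M (m + #O) with h | h | h
    · have : (M : ℚ) < m + #O := mod_cast h
      nlinarith
    · exact h
    · obtain ⟨d, rfl⟩ : ∃ d, M = m + d := ⟨M - m, by omega⟩
      have : (#O : ℚ) < d := by exact_mod_cast (by omega : #O < d)
      have hP := mul_prob_one_le_vcount_le (m := d) fun v hv ↦ by have := hM v hv; omega
      push_cast at heq
      nlinarith
  subst hMO
  have hhit : ∀ t, 1 ≤ vcount O t := by
    refine forall_of_one_le_prob ?_
    push_cast at heq
    nlinarith
  obtain ⟨j, hj⟩ : ∃ j, ∀ x, ⟨j, x⟩ ∈ O := by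
    by_contra! hcon
    choose t ht using hcon
    obtain ⟨v, hv, htv⟩ := one_le_vcount.1 (hhit t)
    exact ht v.1 (htv ▸ hv)
  have hsub : part j ⊆ O := fun v hv ↦ by
    obtain ⟨i, x⟩ := v
    obtain rfl : i = j := mem_part.1 hv
    exact hj x
  have hle : #O ≤ card (V j) := by simpa using hM _ (hj (Classical.arbitrary _))
  have hO : part j = O := eq_of_subset_of_card_le hsub (by rwa [card_part])
  exact ⟨j, hO.symm, by rw [← hO, card_part]⟩

theorem card_mul_sub_prob_two_le_vcount (S : Finset (Σ i, V i)) (i : ι) (N : ℚ) :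
    card (V i) * (#S - 1 - prob (fun t ↦ 2 ≤ vcount S t) * N) =
      #{v ∈ S | v.1 = i} * (#{v ∈ S | v.1 ≠ i} + card (V i) - 1 -
          prob (fun t ↦ 1 ≤ vcount {v ∈ S | v.1 ≠ i} t) * N) +
        (card (V i) - #{v ∈ S | v.1 = i}) *
          (#{v ∈ S | v.1 ≠ i} - 1 - prob (fun t ↦ 2 ≤ vcount {v ∈ S | v.1 ≠ i} t) * N) := by
  have hcard : (#{v ∈ S | v.1 = i} + #{v ∈ S | v.1 ≠ i} : ℚ) = #S := by
    exact_mod_cast card_filter_add_card_filter_not _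
  linear_combination (-N) * card_mul_prob_two_le_vcount S i - card (V i) * hcard

theorem prob_two_le_vcount_mul_le {M : ℕ} (hS : S.Nonempty)
    (hM : ∀ v ∈ S, ∀ w ∈ S, v.1 ≠ w.1 → M ≤ card (V v.1) + card (V w.1)) :
    prob (fun t ↦ 2 ≤ vcount S t) * (M - 1) ≤ #S - 1 := by
  induction hs : #S using Nat.strong_induction_on generalizing S with | _ s ih =>
  subst hs
  obtain ⟨v, hv⟩ := hS
  rcases {w ∈ S | w.1 ≠ v.1}.eq_empty_or_nonempty with hO | hO
  · rw [prob_two_le_vcount_eq_zero (i := v.1) (by simpa [filter_eq_empty_iff] using hO), zero_mul,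
      sub_nonneg]
    exact_mod_cast card_pos.2 ⟨v, hv⟩
  · have hI : 0 < #{w ∈ S | w.1 = v.1} := card_pos.2 ⟨v, by simp [hv]⟩
    have hcard : #{w ∈ S | w.1 = v.1} + #{w ∈ S | w.1 ≠ v.1} = #S :=
      card_filter_add_card_filter_not _
    have h1 := prob_one_le_vcount_mul_le (M := M) Fintype.card_pos hO fun w hw ↦
      hM v hv w (mem_filter.1 hw).1 (mem_filter.1 hw).2.symm
    have h2 := ih _ (by omega) hO
      (fun u hu w hw ↦ hM u (mem_filter.1 hu).1 w (mem_filter.1 hw).1) rfl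
    have hIle : (#{w ∈ S | w.1 = v.1} : ℚ) ≤ card (V v.1) := mod_cast card_filter_fst_eq_le S v.1
    have hpos : (0 : ℚ) < card (V v.1) := mod_cast Fintype.card_pos
    refine sub_nonneg.1 (nonneg_of_mul_nonneg_right ?_ hpos)
    rw [card_mul_sub_prob_two_le_vcount]
    exact add_nonneg (mul_nonneg (Nat.cast_nonneg _) (sub_nonneg.2 h1))
      (mul_nonneg (sub_nonneg.2 hIle) (sub_nonneg.2 h2))

theorem eq_two_parts_of_prob_two_le_vcount_mul_eq {M : ℕ} (hS : 2 ≤ #S)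
    (hM : ∀ v ∈ S, ∀ w ∈ S, v.1 ≠ w.1 → M ≤ card (V v.1) + card (V w.1))
    (h2 : ∀ v ∈ S, 2 ≤ card (V v.1))
    (heq : prob (fun t ↦ 2 ≤ vcount S t) * (M - 1) = #S - 1) :
    ∃ i j, i ≠ j ∧ card (V i) + card (V j) = M ∧ ∀ v, v ∈ S ↔ v.1 = i ∨ v.1 = j := by
  obtain ⟨v, hv⟩ : S.Nonempty := card_pos.1 (by omega)
  have hI : 0 < #{w ∈ S | w.1 = v.1} := card_pos.2 ⟨v, by simp [hv]⟩
  have hIle : (#{w ∈ S | w.1 = v.1} : ℚ) ≤ card (V v.1) := mod_cast card_filter_fst_eq_le S v.1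
  have hO : {w ∈ S | w.1 ≠ v.1}.Nonempty := by
    by_contra! hO
    rw [prob_two_le_vcount_eq_zero (i := v.1) (by simpa [filter_eq_empty_iff] using hO), zero_mul,
      eq_comm, sub_eq_zero] at heq
    have : #S = 1 := mod_cast heq
    omega
  have hOM : ∀ w ∈ {w ∈ S | w.1 ≠ v.1}, M ≤ card (V v.1) + card (V w.1) := fun w hw ↦
    hM v hv w (mem_filter.1 hw).1 (mem_filter.1 hw).2.symm
  have hslack := card_mul_sub_prob_two_le_vcount S v.1 (M - 1)
  rw [heq, sub_self, mul_zero, eq_comm, add_eq_zero_iff_of_nonneg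
    (mul_nonneg (Nat.cast_nonneg _)
      (sub_nonneg.2 (prob_one_le_vcount_mul_le Fintype.card_pos hO hOM)))
    (mul_nonneg (sub_nonneg.2 hIle) (sub_nonneg.2 (prob_two_le_vcount_mul_le hO fun u hu w hw ↦
      hM u (mem_filter.1 hu).1 w (mem_filter.1 hw).1)))] at hslack
  obtain ⟨j, hOj, hjM⟩ := eq_part_of_prob_one_le_vcount_mul_eq (h2 v hv) hO hOM
    (sub_eq_zero.1 ((mul_eq_zero.1 hslack.1).resolve_left (Nat.cast_ne_zero.2 hI.ne'))).symm
  have hjS (x : V j) : (⟨j, x⟩ : Σ i, V i) ∈ {w ∈ S | w.1 ≠ v.1} := by simp [hOj]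
  have hfull : {w ∈ S | w.1 = v.1} = part v.1 := by
    have hB := prob_two_le_vcount_eq_zero (S := {w ∈ S | w.1 ≠ v.1}) (i := j) (by simp [hOj])
    rw [hB, hOj, card_part, zero_mul, sub_zero] at hslack
    have hj2 : (2 : ℚ) ≤ card (V j) := mod_cast h2 _ (mem_filter.1 (hjS (Classical.arbitrary _))).1
    have hcard := sub_eq_zero.1 ((mul_eq_zero.1 hslack.2).resolve_right (by linarith))
    exact eq_of_subset_of_card_le (filter_fst_eq_subset_part S v.1)
      (by rw [card_part]; exact_mod_cast hcard.le)
  refine ⟨v.1, j, (mem_filter.1 (hjS (Classical.arbitrary _))).2.symm, hjM, fun w ↦ ?_⟩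
  rw [← mem_part (j := v.1), ← mem_part (j := j), ← hfull, ← hOj, mem_filter, mem_filter]
  tauto

end VertexBound

section MixedBound

theorem prob_two_le_add_le {Ω : Type*} [Fintype Ω] (f g : Ω → ℕ) :
    prob (fun ω ↦ 2 ≤ f ω + g ω) ≤ prob (fun ω ↦ 2 ≤ f ω) + 𝔼 ω, (g ω : ℚ) := by
  classical
  simp only [prob, ← expect_add_distrib]
  refine expect_le_expect fun ω _ ↦ ?_
  have : (0 : ℚ) ≤ g ω := Nat.cast_nonneg _
  split_ifs with hfg hf <;> try linarith
  have : (1 : ℚ) ≤ g ω := by exact_mod_cast (by omega : 1 ≤ g ω)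
  linarith

/-- Markov's inequality for `b f + a g`, which is at least `a + b` wherever `f + g` is at
least `2`. -/
theorem add_mul_prob_two_le_add_le {Ω : Type*} [Fintype Ω] {f g : Ω → ℕ} (hf : ∀ ω, f ω ≤ 1)
    {a b : ℕ} (hba : b ≤ a) :
    (a + b) * prob (fun ω ↦ 2 ≤ f ω + g ω) ≤ b * 𝔼 ω, (f ω : ℚ) + a * 𝔼 ω, (g ω : ℚ) := by
  simp only [prob, mul_expect, ← expect_add_distrib]
  refine expect_le_expect fun ω _ ↦ ?_
  split_ifs with h
  · have key : a + b ≤ b * f ω + a * g ω := by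
      have hfω := hf ω
      interval_cases f ω <;> nlinarith
    rw [mul_one]
    exact_mod_cast key
  · rw [mul_zero]
    positivity

variable {ι : Type*} {V : ι → Type*} {y : Σ i, V i}

theorem mem_of_forall_spans [Nontrivial (V y.1)] {e : Sym2 (Σ i, V i)}
    (he : ∃ t, Spans t e) (h : ∀ t, Spans t e → t y.1 = y.2) : y ∈ e := by
  classical
  obtain ⟨t, ht⟩ := he
  by_contra hy
  obtain ⟨x, hx⟩ := exists_ne y.2
  have hspans : Spans (Function.update t y.1 x) e := fun v hv ↦ by
    have hvy : v.1 ≠ y.1 := fun hvy ↦ by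
      obtain ⟨i, z⟩ := v
      obtain rfl : i = y.1 := hvy
      obtain rfl : z = y.2 := (ht _ hv).symm.trans (h t ht)
      exact hy hv
    rw [Function.update_of_ne hvy]
    exact ht v hv
  exact hx (by simpa using h _ hspans)

variable {R : Finset (Sym2 (Σ i, V i))}

open scoped Classical in
theorem exists_star_of_ecount_eq [∀ i, Nonempty (V i)] [Nontrivial (V y.1)] (hR : Crossing R)
    (h : ∀ t, ecount R t = if t y.1 = y.2 then 1 else 0) :
    ∃ j, y.1 ≠ j ∧ ∀ e, e ∈ R ↔ ∃ x : V j, e = s(y, ⟨j, x⟩) := by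
  have hle (t) : ecount R t ≤ 1 := by rw [h]; split_ifs <;> simp
  have hcenter : ∀ e ∈ R, ∃ w, e = s(y, w) := by
    intro e he
    refine mem_of_forall_spans ?_ fun t ht ↦ ?_
    · induction e with | _ v w
      simpa using exists_transversal_of_ne (hR he)
    · by_contra hty
      have := (h t).trans (if_neg hty)
      have := one_le_ecount.2 ⟨e, he, ht⟩
      omega
  have hspanned (t : ∀ i, V i) (ht : t y.1 = y.2) : ∃ w, s(y, w) ∈ R ∧ t w.1 = w.2 := by
    obtain ⟨e, he, hte⟩ := one_le_ecount.1 ((h t).trans (if_pos ht)).ge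
    obtain ⟨w, rfl⟩ := hcenter e he
    exact ⟨w, he, (spans_mk.1 hte).2⟩
  obtain ⟨w, hw, -⟩ := hspanned (Function.update (fun _ ↦ Classical.arbitrary _) y.1 y.2) (by simp)
  have hsame (v) (hv : s(y, v) ∈ R) : v.1 = w.1 := by
    by_contra hvw
    obtain ⟨t, hty, htw⟩ := exists_transversal_of_ne (hR hw)
    have h2 : 2 ≤ ecount R (Function.update t v.1 v.2) := by
      refine two_le_ecount.2 ⟨_, hv, _, hw, fun heq ↦ ?_, ?_, ?_⟩
      · exact hvw (congrArg Sigma.fst (Sym2.congr_right.1 heq))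
      · simp [hty, hR hv]
      · simp [hty, htw, hR hv, Ne.symm hvw]
    exact absurd (h2.trans (hle _)) (by simp)
  refine ⟨w.1, hR hw, fun e ↦ ⟨fun he ↦ ?_, ?_⟩⟩
  · obtain ⟨⟨j, x⟩, rfl⟩ := hcenter e he
    obtain rfl : j = w.1 := hsame _ he
    exact ⟨x, rfl⟩
  · rintro ⟨x, rfl⟩
    obtain ⟨t, hty, htx⟩ := exists_transversal_of_ne (v := y) (w := ⟨w.1, x⟩) (hR hw :)
    obtain ⟨⟨j, z⟩, hz, htz⟩ := hspanned t hty
    obtain rfl : j = w.1 := hsame _ hz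
    exact (htz.symm.trans htx : z = x) ▸ hz

variable [∀ i, Fintype (V i)] {S : Finset (Σ i, V i)} {l : ι} {a b : ℕ}

/-- The size condition under which vertices and edges are counted together: the partite set `i` has
at least `a` vertices, or at least `b` if it is the exceptional partite set `l`. It is used with
`b ≤ a`. -/
def Large (V : ι → Type*) [∀ i, Fintype (V i)] (l : ι) (b a : ℕ) (i : ι) : Prop :=
  b ≤ card (V i) ∧ (i ≠ l → a ≤ card (V i))

theorem Large.add_le {i j : ι} (hi : Large V l b a i) (hj : Large V l b a j) (hij : i ≠ j) :
    a + b ≤ card (V i) + card (V j) := by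
  rcases eq_or_ne i l with rfl | hil
  · exact (add_comm a b).trans_le (add_le_add hi.1 (hj.2 hij.symm))
  · exact add_le_add (hi.2 hil) hj.1

theorem Large.mul_le {i j : ι} (hi : Large V l b a i) (hj : Large V l b a j) (hij : i ≠ j) :
    a * b ≤ card (V i) * card (V j) := by
  rcases eq_or_ne i l with rfl | hil
  · exact (mul_comm a b).trans_le (Nat.mul_le_mul hi.1 (hj.2 hij.symm))
  · exact Nat.mul_le_mul (hi.2 hil) hj.1

variable [Fintype ι] [DecidableEq ι] [∀ i, Nonempty (V i)]

theorem mul_expect_ecount_le_of_large (hR : Crossing R)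
    (hRl : ∀ e ∈ R, ∀ v ∈ e, Large V l b a v.1) :
    a * b * 𝔼 t, (ecount R t : ℚ) ≤ #R := by
  have := mul_expect_ecount_le hR (m := a * b) fun v w he ↦
    (hRl _ he v (by simp)).mul_le (hRl _ he w (by simp)) (hR he)
  exact_mod_cast this

/-- The better of the two bounds if `R` has at most `a` edges. -/
theorem prob_two_le_vcount_add_ecount_le_of_few (hS : S.Nonempty)
    (hSl : ∀ v ∈ S, Large V l b a v.1) (hb : 1 ≤ b) (hR : Crossing R)
    (hRl : ∀ e ∈ R, ∀ v ∈ e, Large V l b a v.1) :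
    a * b * (a + b - 1) * prob (fun t ↦ 2 ≤ vcount S t + ecount R t) ≤
      a * b * (#S - 1) + (a + b - 1) * #R := by
  have hvertices := prob_two_le_vcount_mul_le (M := a + b) hS fun v hv w hw ↦
    (hSl v hv).add_le (hSl w hw)
  push_cast at hvertices
  have hab : (0 : ℚ) ≤ a + b - 1 := by
    rw [sub_nonneg]
    exact_mod_cast (by omega : 1 ≤ a + b)
  calc a * b * (a + b - 1) * prob (fun t ↦ 2 ≤ vcount S t + ecount R t)
      ≤ a * b * (a + b - 1) * (prob (fun t ↦ 2 ≤ vcount S t) + 𝔼 t, (ecount R t : ℚ)) := by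
        gcongr; exact prob_two_le_add_le _ _
    _ = a * b * (prob (fun t ↦ 2 ≤ vcount S t) * (a + b - 1)) +
          (a + b - 1) * (a * b * 𝔼 t, (ecount R t : ℚ)) := by ring
    _ ≤ a * b * (#S - 1) + (a + b - 1) * #R := by
        gcongr; exact mul_expect_ecount_le_of_large hR hRl

/-- The better of the two bounds if `R` has at least `a` edges. -/
theorem prob_two_le_vcount_add_ecount_le_of_many (hSl : ∀ v ∈ S, Large V l b a v.1) (hba : b ≤ a)
    (hR : Crossing R) (hRl : ∀ e ∈ R, ∀ v ∈ e, Large V l b a v.1) :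
    b * (a + b) * prob (fun t ↦ 2 ≤ vcount S t + ecount R t) ≤ b * #S + #R := by
  have hcard : (#{v ∈ S | v.1 = l} + #{v ∈ S | v.1 ≠ l} : ℚ) = #S := by
    exact_mod_cast card_filter_add_card_filter_not _
  have hin := mul_expect_vcount_le (S := {v ∈ S | v.1 = l}) fun v hv ↦
    (hSl v (mem_filter.1 hv).1).1
  have hout := mul_expect_vcount_le (S := {v ∈ S | v.1 ≠ l}) fun v hv ↦
    (hSl v (mem_filter.1 hv).1).2 (mem_filter.1 hv).2
  have hedges := mul_expect_ecount_le_of_large hR hRl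
  have hmarkov := add_mul_prob_two_le_add_le (f := vcount {v ∈ S | v.1 = l})
    (g := fun t ↦ vcount {v ∈ S | v.1 ≠ l} t + ecount R t)
    (fun t ↦ vcount_le_one (i := l) fun v hv ↦ (mem_filter.1 hv).2) hba
  simp only [← add_assoc, vcount_filter_add, Nat.cast_add, expect_add_distrib] at hmarkov
  have hb : (0 : ℚ) ≤ b := b.cast_nonneg
  nlinarith [mul_le_mul_of_nonneg_left hmarkov hb, mul_le_mul_of_nonneg_left hin hb,
    mul_le_mul_of_nonneg_left hout hb]

theorem prob_two_le_vcount_add_ecount_le (hS : S.Nonempty) (hSl : ∀ v ∈ S, Large V l b a v.1)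
    (hb : 1 ≤ b) (hba : b ≤ a) (hR : Crossing R) (hRl : ∀ e ∈ R, ∀ v ∈ e, Large V l b a v.1) :
    b * (a + b - 1) * prob (fun t ↦ 2 ≤ vcount S t + ecount R t) ≤ b * #S + (#R - 1) := by
  have hfew := prob_two_le_vcount_add_ecount_le_of_few hS hSl hb hR hRl
  have hmany := prob_two_le_vcount_add_ecount_le_of_many hSl hba hR hRl
  have : (1 : ℚ) ≤ b := mod_cast hb
  have : (b : ℚ) ≤ a := mod_cast hba
  have : (1 : ℚ) ≤ #S := mod_cast hS.card_pos
  rcases le_total #R a with h | h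
  · have : (#R : ℚ) ≤ a := mod_cast h
    refine le_of_mul_le_mul_left ?_ (by linarith : (0 : ℚ) < a)
    nlinarith
  · have : (a : ℚ) ≤ #R := mod_cast h
    refine le_of_mul_le_mul_left ?_ (by linarith : (0 : ℚ) < a + b)
    nlinarith [mul_le_mul_of_nonneg_left hmany (by linarith : (0 : ℚ) ≤ a + b - 1)]

theorem card_eq_of_prob_two_le_vcount_add_ecount_eq (hS : S.Nonempty)
    (hSl : ∀ v ∈ S, Large V l b a v.1) (hb : 2 ≤ b) (hba : b ≤ a) (hR : Crossing R)
    (hRl : ∀ e ∈ R, ∀ v ∈ e, Large V l b a v.1)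
    (heq : b * (a + b - 1) * prob (fun t ↦ 2 ≤ vcount S t + ecount R t) = b * #S + (#R - 1)) :
    #S = 1 ∧ #R = a := by
  have hfew := prob_two_le_vcount_add_ecount_le_of_few hS hSl (by omega) hR hRl
  have hmany := prob_two_le_vcount_add_ecount_le_of_many hSl hba hR hRl
  have : (2 : ℚ) ≤ b := mod_cast hb
  have : (b : ℚ) ≤ a := mod_cast hba
  have hS1 : (1 : ℚ) ≤ #S := mod_cast hS.card_pos
  have hle : b * #S + #R ≤ (a + b : ℚ) := by
    nlinarith [mul_le_mul_of_nonneg_left hmany (by linarith : (0 : ℚ) ≤ a + b - 1)]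
  have hge : (a : ℚ) ≤ #R := by nlinarith
  have hSle : (#S : ℚ) ≤ 1 := by nlinarith
  have hRle : (#R : ℚ) ≤ a := by nlinarith
  exact ⟨mod_cast hSle.antisymm hS1, mod_cast hRle.antisymm hge⟩

open scoped Classical in
theorem ecount_eq_of_prob_two_le_vcount_singleton_add_ecount (hy : b ≤ card (V y.1))
    (hb : 1 ≤ b) (hba : b ≤ a) (hR : Crossing R) (hRl : ∀ e ∈ R, ∀ v ∈ e, Large V l b a v.1)
    (hRa : #R = a) (heq : b * prob (fun t ↦ 2 ≤ vcount {y} t + ecount R t) = 1) :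
    card (V y.1) = b ∧ ∀ t, ecount R t = if t y.1 = y.2 then 1 else 0 := by
  have hb0 : (0 : ℚ) < b := mod_cast hb
  have ha0 : (0 : ℚ) < a := mod_cast hb.trans hba
  have hvcount (t : ∀ i, V i) : vcount {y} t = if t y.1 = y.2 then 1 else 0 := by
    simp [vcount, filter_singleton, apply_ite Finset.card]
  have hecount := eq_ite_of_expect_le_prob (p := fun t ↦ 2 ≤ vcount {y} t + ecount R t)
    (f := ecount R) (fun t ht ↦ by have := hvcount t; split_ifs at this <;> omega) <| by
      have hedges := mul_expect_ecount_le_of_large hR hRl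
      rw [hRa] at hedges
      refine le_of_mul_le_mul_left (hedges.trans_eq ?_) (mul_pos ha0 hb0)
      linear_combination (-a : ℚ) * heq
  have hmem (t : ∀ i, V i) (ht : 2 ≤ vcount {y} t + ecount R t) : t y.1 = y.2 := by
    by_contra hty
    have : ecount R t = 1 := (hecount t).trans (if_pos ht)
    rw [hvcount, if_neg hty] at ht
    omega
  have hcard0 : (0 : ℚ) < card (V y.1) := mod_cast Fintype.card_pos
  have hprob : prob (fun t ↦ 2 ≤ vcount {y} t + ecount R t) = (b : ℚ)⁻¹ :=
    eq_inv_of_mul_eq_one_right heq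
  have hcard : card (V y.1) = b := by
    have hle := prob_mono hmem
    rw [prob_apply_eq, hprob, inv_le_inv₀ hb0 hcard0] at hle
    exact le_antisymm (mod_cast hle) hy
  refine ⟨hcard, fun t ↦ ?_⟩
  have hiff := iff_of_prob_le hmem (by rw [prob_apply_eq, hprob, hcard]) t
  exact (hecount t).trans (by simp only [hiff])

theorem exists_star_of_prob_two_le_vcount_add_ecount_eq (hS : S.Nonempty)
    (hSl : ∀ v ∈ S, Large V l b a v.1) (hb : 2 ≤ b) (hba : b ≤ a) (hR : Crossing R)
    (hRl : ∀ e ∈ R, ∀ v ∈ e, Large V l b a v.1)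
    (heq : b * (a + b - 1) * prob (fun t ↦ 2 ≤ vcount S t + ecount R t) = b * #S + (#R - 1)) :
    ∃ y j, y.1 ≠ j ∧ card (V y.1) = b ∧ card (V j) = a ∧ S = {y} ∧
      (∀ e, e ∈ R ↔ ∃ x : V j, e = s(y, ⟨j, x⟩)) ∧ ∀ t, ecount R t ≤ 1 := by
  classical
  obtain ⟨hS1, hRa⟩ := card_eq_of_prob_two_le_vcount_add_ecount_eq hS hSl hb hba hR hRl heq
  obtain ⟨y, rfl⟩ := card_eq_one.1 hS1
  have hb2 : (2 : ℚ) ≤ b := mod_cast hb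
  have hba' : (b : ℚ) ≤ a := mod_cast hba
  obtain ⟨hyb, hecount⟩ := ecount_eq_of_prob_two_le_vcount_singleton_add_ecount
    (hSl y (by simp)).1 (by omega) hba hR hRl hRa <| by
      rw [hRa, card_singleton] at heq
      push_cast at heq
      nlinarith
  have : Nontrivial (V y.1) := Fintype.one_lt_card_iff_nontrivial.1 (by omega)
  obtain ⟨j, hyj, hstar⟩ := exists_star_of_ecount_eq hR hecount
  have hRstar : R = univ.map
      ((Function.Embedding.sigmaMk j).trans (Sym2.mkEmbedding y)) := by
    ext e
    simp [hstar, eq_comm]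
  refine ⟨y, j, hyj, hyb, ?_, rfl, hstar, fun t ↦ ?_⟩
  · rw [← hRa, hRstar, card_map, card_univ]
  · rw [hecount]
    split_ifs <;> simp

end MixedBound

section Fibers

variable {ι : Type*} {V : ι → Type*} {F : Finset (Sym2 (Σ i, V i))} {κ : ι} {u : V κ}
  {v : Σ i, V i} {e : Sym2 (Σ i, V i)}

open scoped Classical in
/-- The edges of `F` with no end in the partite set `κ`. -/
noncomputable def away (F : Finset (Sym2 (Σ i, V i))) (κ : ι) : Finset (Sym2 (Σ i, V i)) :=
  {e ∈ F | ∀ v ∈ e, v.1 ≠ κ}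

theorem mem_away : e ∈ away F κ ↔ e ∈ F ∧ ∀ v ∈ e, v.1 ≠ κ := by classical exact mem_filter

theorem Crossing.away (hF : Crossing F) (κ : ι) : Crossing (away F κ) :=
  fun _ _ h ↦ hF (mem_away.1 h).1

variable [Fintype ι] [∀ i, Fintype (V i)]

open scoped Classical in
/-- The neighbors of the vertex `u` of the partite set `κ` in the graph with edge set `F`. -/
noncomputable def starAt (F : Finset (Sym2 (Σ i, V i))) (κ : ι) (u : V κ) : Finset (Σ i, V i) :=
  {v | s(⟨κ, u⟩, v) ∈ F}

theorem mem_starAt : v ∈ starAt F κ u ↔ s(⟨κ, u⟩, v) ∈ F := by simp [starAt]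

theorem ne_of_mem_starAt (hF : Crossing F) (hv : v ∈ starAt F κ u) : v.1 ≠ κ :=
  (hF (mem_starAt.1 hv)).symm

theorem mem_iff_mem_starAt_or_mem_away :
    e ∈ F ↔ (∃ u, ∃ v ∈ starAt F κ u, e = s(⟨κ, u⟩, v)) ∨ e ∈ away F κ := by
  constructor
  · intro he
    by_cases h : ∀ v ∈ e, v.1 ≠ κ
    · exact Or.inr (mem_away.2 ⟨he, h⟩)
    · push Not at h
      obtain ⟨⟨i, u⟩, hu, rfl⟩ := h
      obtain ⟨v, rfl⟩ := Sym2.mem_iff_exists.1 hu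
      exact Or.inl ⟨u, v, mem_starAt.2 he, rfl⟩
  · rintro (⟨u, v, hv, rfl⟩ | h)
    exacts [mem_starAt.1 hv, (mem_away.1 h).1]

theorem sum_starAt_add_sum_away (hF : Crossing F) (κ : ι) (g : Sym2 (Σ i, V i) → ℕ) :
    ∑ u, ∑ v ∈ starAt F κ u, g s(⟨κ, u⟩, v) + ∑ e ∈ away F κ, g e = ∑ e ∈ F, g e := by
  classical
  have haway : {e ∈ F | ∀ v ∈ e, v.1 ≠ κ} = away F κ := by ext; rw [mem_filter, mem_away]
  rw [add_comm, ← sum_filter_add_sum_filter_not F (fun e ↦ ∀ v ∈ e, v.1 ≠ κ), haway, sum_sigma',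
    Nat.add_left_cancel_iff]
  refine sum_bij (fun p _ ↦ s(⟨κ, p.1⟩, p.2)) ?_ ?_ ?_ fun _ _ ↦ rfl
  · rintro ⟨u, v⟩ h
    exact mem_filter.2 ⟨mem_starAt.1 (mem_sigma.1 h).2, fun hn ↦ hn ⟨κ, u⟩ (by simp) rfl⟩
  · rintro ⟨u, v⟩ - ⟨u', v'⟩ h' heq
    have hv' := ne_of_mem_starAt hF (mem_sigma.1 h').2
    rcases Sym2.eq_iff.1 heq with huv | ⟨hu, -⟩
    · simp_all
    · exact absurd (congrArg Sigma.fst hu).symm hv'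
  · intro e he
    obtain ⟨he, hκ⟩ := mem_filter.1 he
    obtain ⟨u, v, hv, rfl⟩ | haway := (mem_iff_mem_starAt_or_mem_away (κ := κ)).1 he
    · exact ⟨⟨u, v⟩, by simp [hv], rfl⟩
    · exact absurd (mem_away.1 haway).2 hκ

theorem sum_card_starAt_add_card_away (hF : Crossing F) (κ : ι) :
    ∑ u, #(starAt F κ u) + #(away F κ) = #F := by
  simpa using sum_starAt_add_sum_away hF κ fun _ ↦ 1

theorem card_away_lt (hu : (starAt F κ u).Nonempty) : #(away F κ) < #F := by
  obtain ⟨v, hv⟩ := hu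
  refine card_lt_card ⟨fun e he ↦ (mem_away.1 he).1, fun h ↦ ?_⟩
  exact (mem_away.1 (h (mem_starAt.1 hv))).2 ⟨κ, u⟩ (by simp) rfl

variable [DecidableEq ι]

theorem ecount_update (hF : Crossing F) (κ : ι) (u : V κ) (t : ∀ i, V i) :
    ecount F (Function.update t κ u) = vcount (starAt F κ u) t + ecount (away F κ) t := by
  classical
  simp only [ecount, vcount, card_filter]
  rw [← sum_starAt_add_sum_away hF κ, sum_eq_single u]
  · congr 1
    · refine sum_congr rfl fun v hv ↦ ?_
      simp [ne_of_mem_starAt hF hv]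
    · refine sum_congr rfl fun e he ↦ if_congr (forall₂_congr fun v hv ↦ ?_) rfl rfl
      rw [Function.update_of_ne ((mem_away.1 he).2 v hv)]
  · intro u' _ hu'
    exact sum_eq_zero fun v _ ↦ if_neg fun h ↦ hu' (by simpa using (spans_mk.1 h).1.symm)
  · simp

theorem card_mul_prob_two_le_ecount [∀ i, Nonempty (V i)] (hF : Crossing F) (κ : ι) :
    card (V κ) * prob (fun t ↦ 2 ≤ ecount F t) =
      ∑ u, prob fun t ↦ 2 ≤ vcount (starAt F κ u) t + ecount (away F κ) t := by
  rw [prob_eq_expect_prob_update κ, Fintype.card_mul_expect]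
  simp only [ecount_update hF]

end Fibers

section ClassBound

variable {ι : Type*} {V : ι → Type*} {F : Finset (Sym2 (Σ i, V i))} {κ l : ι} {a b c M : ℕ}

/-- The edges between the vertex `y` and the partite sets `i` and `j`. -/
def fullStar (y : Σ i, V i) (i j : ι) : Set (Sym2 (Σ i, V i)) :=
  {e | ∃ w, (w.1 = i ∨ w.1 = j) ∧ e = s(y, w)}

variable [∀ i, Fintype (V i)]

/-- The set `F` consists of all edges between a vertex in a partite set of size `c` and two other
partite sets of total size `M`. These are the sets of edges with equality in the class bound. -/
def IsFullStar (F : Finset (Sym2 (Σ i, V i))) (c M : ℕ) : Prop :=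
  ∃ (y : Σ i, V i) (i j : ι), i ≠ j ∧ y.1 ≠ i ∧ y.1 ≠ j ∧ card (V y.1) = c ∧
    card (V i) + card (V j) = M ∧ ∀ e, e ∈ F ↔ e ∈ fullStar y i j

/-- The set `F` only meets partite sets that are `Large`, apart from the partite set `κ`. -/
def LargeOff (F : Finset (Sym2 (Σ i, V i))) (κ l : ι) (b a : ℕ) : Prop :=
  ∀ e ∈ F, ∀ v ∈ e, v.1 ≠ κ → Large V l b a v.1

/-- The numbers `c ≤ b ≤ a` bound from below the smallest, the second smallest and all other sizes
of the partite sets met by `F`. -/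
def SizesAtLeast (F : Finset (Sym2 (Σ i, V i))) (c b a : ℕ) : Prop :=
  (∀ e ∈ F, ∀ v ∈ e, c ≤ card (V v.1)) ∧ ∃ κ l, LargeOff F κ l b a

theorem LargeOff.large_of_mem_away (h : LargeOff F κ l b a) :
    ∀ e ∈ away F κ, ∀ v ∈ e, Large V l b a v.1 :=
  fun e he v hv ↦ h e (mem_away.1 he).1 v hv ((mem_away.1 he).2 v hv)

theorem LargeOff.sizesAtLeast_away (h : LargeOff F κ l b a) : SizesAtLeast (away F κ) b a a := by
  refine ⟨fun e he v hv ↦ (h.large_of_mem_away e he v hv).1, l, l, fun e he v hv hvl ↦ ?_⟩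
  have hav := (h.large_of_mem_away e he v hv).2 hvl
  exact ⟨hav, fun _ ↦ hav⟩

variable [Fintype ι]

theorem LargeOff.large_of_mem_starAt (h : LargeOff F κ l b a) (hF : Crossing F) (u : V κ) :
    ∀ v ∈ starAt F κ u, Large V l b a v.1 :=
  fun v hv ↦ h _ (mem_starAt.1 hv) v (by simp) (ne_of_mem_starAt hF hv)

theorem SizesAtLeast.exists_starAt_nonempty (h : SizesAtLeast F c b a) (hF : F.Nonempty)
    (hba : b ≤ a) :
    ∃ κ l, LargeOff F κ l b a ∧ c ≤ card (V κ) ∧ ∃ u, (starAt F κ u).Nonempty := by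
  obtain ⟨hc, κ, l, h⟩ := h
  have hmet {e v} (he : e ∈ F) (hv : v ∈ e) :
      c ≤ card (V v.1) ∧ ∃ u, (starAt F v.1 u).Nonempty := by
    obtain ⟨w, rfl⟩ := Sym2.mem_iff_exists.1 hv
    exact ⟨hc _ he v hv, v.2, w, mem_starAt.2 he⟩
  by_cases hκ : ∃ e ∈ F, ∃ v ∈ e, v.1 = κ
  · obtain ⟨e, he, v, hv, rfl⟩ := hκ
    exact ⟨v.1, l, h, hmet he hv⟩
  push Not at hκ
  by_cases hl : ∃ e ∈ F, ∃ v ∈ e, v.1 = l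
  · obtain ⟨e, he, v, hv, rfl⟩ := hl
    refine ⟨v.1, v.1, fun e he w hw hwv ↦ ?_, hmet he hv⟩
    have haw := (h e he w hw (hκ e he w hw)).2 hwv
    exact ⟨hba.trans haw, fun _ ↦ haw⟩
  · obtain ⟨e, he⟩ := hF
    exact ⟨_, l, fun e he w hw _ ↦ h e he w hw (hκ e he w hw), hmet he e.out_fst_mem⟩

open scoped Classical in
theorem sum_card_starAt_sub_of_away_eq_empty (hF : Crossing F) (haway : away F κ = ∅) (u₀ : V κ) :
    ∑ u, ((#(starAt F κ u) : ℚ) - if u = u₀ then 1 else 0) = #F - 1 := by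
  rw [sum_sub_distrib, ← sum_card_starAt_add_card_away hF κ, haway]
  simp

theorem sum_mul_card_starAt_add (hF : Crossing F) (κ : ι) (b : ℚ) :
    ∑ u, (b * #(starAt F κ u) + (#(away F κ) - 1)) =
      b * (#F - 1) - (b - card (V κ)) * (#(away F κ) - 1) := by
  rw [sum_add_distrib, ← mul_sum, ← sum_card_starAt_add_card_away hF κ, sum_const, card_univ,
    nsmul_eq_mul]
  push_cast
  ring

variable [∀ i, Nonempty (V i)]

theorem isFullStar_of_starAt_eq_singleton {y : Σ i, V i} {j : ι} (hF : Crossing F)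
    (hyj : y.1 ≠ j) (hstar : ∀ u, starAt F κ u = {y})
    (haway : ∀ e, e ∈ away F κ ↔ ∃ x : V j, e = s(y, ⟨j, x⟩)) :
    IsFullStar F (card (V y.1)) (card (V κ) + card (V j)) := by
  obtain ⟨u⟩ : Nonempty (V κ) := inferInstance
  obtain ⟨x⟩ : Nonempty (V j) := inferInstance
  have hκj : κ ≠ j := ((mem_away.1 ((haway _).2 ⟨x, rfl⟩)).2 ⟨j, x⟩ (by simp)).symm
  have hyκ : y.1 ≠ κ := ne_of_mem_starAt hF (u := u) (by simp [hstar])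
  refine ⟨y, κ, j, hκj, hyκ, hyj, rfl, rfl, fun e ↦ ?_⟩
  rw [mem_iff_mem_starAt_or_mem_away (κ := κ), haway]
  constructor
  · rintro (⟨u, v, hv, rfl⟩ | ⟨x, rfl⟩)
    · rw [hstar, mem_singleton] at hv
      exact ⟨⟨κ, u⟩, Or.inl rfl, by rw [hv, Sym2.eq_swap]⟩
    · exact ⟨⟨j, x⟩, Or.inr rfl, rfl⟩
  · rintro ⟨⟨i, w⟩, hi | hi, rfl⟩ <;> obtain rfl : i = _ := hi
    · exact Or.inl ⟨w, y, by simp [hstar], Sym2.eq_swap⟩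
    · exact Or.inr ⟨w, rfl⟩

variable [DecidableEq ι] {u₀ : V κ}

open scoped Classical in
theorem prob_two_le_vcount_starAt_mul_le (hF : Crossing F) (h : LargeOff F κ l b a)
    (hu₀ : (starAt F κ u₀).Nonempty) (u : V κ) :
    prob (fun t ↦ 2 ≤ vcount (starAt F κ u) t) * (a + b - 1) ≤
      #(starAt F κ u) - if u = u₀ then 1 else 0 := by
  rcases (starAt F κ u).eq_empty_or_nonempty with hu | hu
  · have : u ≠ u₀ := by rintro rfl; exact hu₀.ne_empty hu
    simp [hu, this, vcount, prob]
  · have hle := prob_two_le_vcount_mul_le (M := a + b) hu fun v hv w hw ↦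
      (h.large_of_mem_starAt hF u v hv).add_le (h.large_of_mem_starAt hF u w hw)
    push_cast at hle
    refine hle.trans ?_
    split_ifs <;> simp

theorem card_mul_prob_two_le_ecount_of_away_eq_empty (hF : Crossing F) (haway : away F κ = ∅)
    (N : ℚ) : card (V κ) * N * prob (fun t ↦ 2 ≤ ecount F t) =
      ∑ u, prob (fun t ↦ 2 ≤ vcount (starAt F κ u) t) * N := by
  rw [mul_right_comm, card_mul_prob_two_le_ecount hF κ, haway, sum_mul]
  simp [ecount]

theorem card_mul_prob_two_le_ecount_le_of_away_eq_empty (hF : Crossing F)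
    (h : LargeOff F κ l b a) (hu₀ : (starAt F κ u₀).Nonempty) (haway : away F κ = ∅) :
    card (V κ) * (a + b - 1) * prob (fun t ↦ 2 ≤ ecount F t) ≤ #F - 1 := by
  rw [card_mul_prob_two_le_ecount_of_away_eq_empty hF haway,
    ← sum_card_starAt_sub_of_away_eq_empty hF haway u₀]
  exact sum_le_sum fun u _ ↦ prob_two_le_vcount_starAt_mul_le hF h hu₀ u

theorem isFullStar_of_away_eq_empty (hF : Crossing F) (h : LargeOff F κ l b a)
    (hu₀ : (starAt F κ u₀).Nonempty) (haway : away F κ = ∅) (hb : 2 ≤ b) (hF2 : 2 ≤ #F)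
    (heq : card (V κ) * (a + b - 1) * prob (fun t ↦ 2 ≤ ecount F t) = #F - 1) :
    IsFullStar F (card (V κ)) (a + b) := by
  rw [card_mul_prob_two_le_ecount_of_away_eq_empty hF haway,
    ← sum_card_starAt_sub_of_away_eq_empty hF haway u₀,
    sum_eq_sum_iff_of_le fun u _ ↦ prob_two_le_vcount_starAt_mul_le hF h hu₀ u] at heq
  have hempty (u : V κ) (hu : u ≠ u₀) : starAt F κ u = ∅ := by
    by_contra! hne
    have hle := prob_two_le_vcount_starAt_mul_le hF h hne u
    rw [heq u (mem_univ u), if_neg hu, if_pos rfl] at hle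
    linarith
  have hcard : #(starAt F κ u₀) = #F := by
    rw [← sum_card_starAt_add_card_away hF κ, haway, card_empty, add_zero]
    exact (sum_eq_single u₀ (fun u _ hu ↦ card_eq_zero.2 (hempty u hu))
      fun h ↦ absurd (mem_univ _) h).symm
  obtain ⟨i, j, hij, hM, hS⟩ := eq_two_parts_of_prob_two_le_vcount_mul_eq (hcard ▸ hF2)
    (fun v hv w hw ↦ (h.large_of_mem_starAt hF u₀ v hv).add_le (h.large_of_mem_starAt hF u₀ w hw))
    (fun v hv ↦ hb.trans (h.large_of_mem_starAt hF u₀ v hv).1) (by simpa using heq u₀ (mem_univ _))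
  have hκ (i : ι) (hi : ∀ x : V i, ⟨i, x⟩ ∈ starAt F κ u₀) : κ ≠ i :=
    (ne_of_mem_starAt hF (hi (Classical.arbitrary _))).symm
  refine ⟨⟨κ, u₀⟩, i, j, hij, hκ i fun x ↦ by simp [hS], hκ j fun x ↦ by simp [hS], rfl, hM,
    fun e ↦ ?_⟩
  rw [mem_iff_mem_starAt_or_mem_away (κ := κ), haway]
  constructor
  · rintro (⟨u, v, hv, rfl⟩ | he)
    · obtain rfl : u = u₀ := by
        by_contra hu
        simp [hempty u hu] at hv
      exact ⟨v, (hS v).1 hv, rfl⟩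
    · simp at he
  · rintro ⟨w, hw, rfl⟩
    exact Or.inl ⟨u₀, w, (hS w).2 hw, rfl⟩

theorem prob_two_le_vcount_starAt_add_ecount_away_le (hF : Crossing F) (h : LargeOff F κ l b a)
    (hb : 1 ≤ b) (hba : b ≤ a)
    (hR : b * (a + a - 1) * prob (fun t ↦ 2 ≤ ecount (away F κ) t) ≤ #(away F κ) - 1) (u : V κ) :
    b * (a + b - 1) * prob (fun t ↦ 2 ≤ vcount (starAt F κ u) t + ecount (away F κ) t) ≤
      b * #(starAt F κ u) + (#(away F κ) - 1) := by
  rcases (starAt F κ u).eq_empty_or_nonempty with hu | hu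
  · rw [hu]
    simp only [vcount, filter_empty, card_empty, zero_add, Nat.cast_zero, mul_zero]
    refine le_trans ?_ hR
    have : 0 ≤ prob fun t ↦ 2 ≤ ecount (away F κ) t := prob_nonneg
    gcongr
  · exact prob_two_le_vcount_add_ecount_le hu (h.large_of_mem_starAt hF u) hb hba (hF.away κ)
      h.large_of_mem_away

theorem mul_card_mul_prob_two_le_ecount (hF : Crossing F) (κ : ι) (b N : ℚ) :
    b * (card (V κ) * N * prob (fun t ↦ 2 ≤ ecount F t)) =
      ∑ u, b * N * prob fun t ↦ 2 ≤ vcount (starAt F κ u) t + ecount (away F κ) t := by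
  rw [← mul_sum, ← card_mul_prob_two_le_ecount hF]
  ring

theorem mul_card_mul_prob_two_le_ecount_le (hF : Crossing F) (h : LargeOff F κ l b a)
    (hb : 1 ≤ b) (hba : b ≤ a)
    (hR : b * (a + a - 1) * prob (fun t ↦ 2 ≤ ecount (away F κ) t) ≤ #(away F κ) - 1) :
    b * (card (V κ) * (a + b - 1) * prob (fun t ↦ 2 ≤ ecount F t)) ≤
      b * (#F - 1) - (b - card (V κ)) * (#(away F κ) - 1) := by
  rw [mul_card_mul_prob_two_le_ecount hF, ← sum_mul_card_starAt_add hF]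
  exact sum_le_sum fun u _ ↦ prob_two_le_vcount_starAt_add_ecount_away_le hF h hb hba hR u

theorem prob_two_le_ecount_le (hF : Crossing F) (hF0 : F.Nonempty) (hs : SizesAtLeast F c b a)
    (hb : 1 ≤ b) (hcb : c ≤ b) (hba : b ≤ a) :
    c * (a + b - 1) * prob (fun t ↦ 2 ≤ ecount F t) ≤ #F - 1 := by
  induction hm : #F using Nat.strong_induction_on generalizing F c b a with | _ m ih =>
  subst hm
  obtain ⟨κ, l, h, hcκ, u, hu⟩ := hs.exists_starAt_nonempty hF0 hba
  have hcκ' : (c : ℚ) ≤ card (V κ) := mod_cast hcκ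
  have hb' : (1 : ℚ) ≤ b := mod_cast hb
  have hba' : (b : ℚ) ≤ a := mod_cast hba
  have hcb' : (c : ℚ) ≤ b := mod_cast hcb
  set X : ℚ := (a + b - 1) * prob (fun t ↦ 2 ≤ ecount F t)
  have hX0 : 0 ≤ X := mul_nonneg (by linarith) prob_nonneg
  rcases (away F κ).eq_empty_or_nonempty with haway | haway
  · have := card_mul_prob_two_le_ecount_le_of_away_eq_empty hF h hu haway
    nlinarith
  · have hlt := card_away_lt hu
    have hlt' : (#(away F κ) : ℚ) < #F := mod_cast hlt
    have hR := ih _ hlt (hF.away κ) haway h.sizesAtLeast_away (hb.trans hba) hba le_rfl rfl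
    have hsum := mul_card_mul_prob_two_le_ecount_le hF h hb hba hR
    have hone : (1 : ℚ) ≤ #(away F κ) := mod_cast haway.card_pos
    rcases le_total (card (V κ) : ℚ) b with hκ | hκ
    · refine le_of_mul_le_mul_left ?_ (by linarith : (0 : ℚ) < b)
      nlinarith [mul_le_mul_of_nonneg_right hcκ' hX0]
    · refine le_of_mul_le_mul_left ?_ (by linarith : (0 : ℚ) < card (V κ))
      nlinarith [mul_le_mul_of_nonneg_right hcb' hX0]

theorem isFullStar_of_prob_two_le_vcount_starAt_add_ecount_away_eq (hF : Crossing F)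
    (h : LargeOff F κ l b a) (hu₀ : (starAt F κ u₀).Nonempty) (hb : 2 ≤ b) (hba : b ≤ a)
    (heq : ∀ u, b * (a + b - 1) *
      prob (fun t ↦ 2 ≤ vcount (starAt F κ u) t + ecount (away F κ) t) =
        b * #(starAt F κ u) + (#(away F κ) - 1)) :
    #(away F κ) = a ∧ IsFullStar F b (card (V κ) + a) := by
  have hstar (u : V κ) (hu : (starAt F κ u).Nonempty) :=
    exists_star_of_prob_two_le_vcount_add_ecount_eq hu (h.large_of_mem_starAt hF u) hb hba
      (hF.away κ) h.large_of_mem_away (heq u)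
  obtain ⟨-, hRa⟩ := card_eq_of_prob_two_le_vcount_add_ecount_eq hu₀
    (h.large_of_mem_starAt hF u₀) hb hba (hF.away κ) h.large_of_mem_away (heq u₀)
  obtain ⟨y, j, hyj, hyb, hja, -, hR, hR1⟩ := hstar u₀ hu₀
  refine ⟨hRa, ?_⟩
  rw [← hyb, ← hja]
  refine isFullStar_of_starAt_eq_singleton hF hyj (fun u ↦ ?_) hR
  rcases (starAt F κ u).eq_empty_or_nonempty with hu | hu
  · have h0 := heq u
    have hnone (t) : ¬ 2 ≤ vcount (starAt F κ u) t + ecount (away F κ) t := by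
      have := hR1 t
      simp only [hu, vcount, filter_empty, card_empty, zero_add]
      omega
    rw [prob_eq_zero hnone, hRa, hu, card_empty] at h0
    have : (2 : ℚ) ≤ a := mod_cast hb.trans hba
    simp only [mul_zero, Nat.cast_zero, zero_add] at h0
    linarith
  · obtain ⟨y', j', -, -, -, hSy', hR', -⟩ := hstar u hu
    rw [hSy', singleton_inj]
    by_contra hne
    have hall (x : V j) : y' = ⟨j, x⟩ := by
      obtain ⟨w, hw⟩ := (hR' _).1 ((hR _).2 ⟨x, rfl⟩)
      rcases Sym2.eq_iff.1 hw with ⟨hy, -⟩ | ⟨-, hy⟩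
      exacts [absurd hy.symm hne, hy.symm]
    have : Nontrivial (V j) := Fintype.one_lt_card_iff_nontrivial.1 (by omega)
    obtain ⟨x, x', hxx'⟩ := exists_pair_ne (V j)
    exact hxx' (by simpa using (hall x).symm.trans (hall x'))

theorem card_eq_of_prob_two_le_ecount_eq (hF : Crossing F) (h : LargeOff F κ l b a)
    (hu₀ : (starAt F κ u₀).Nonempty) (haway : (away F κ).Nonempty) (hb : 1 ≤ b) (hcb : c ≤ b)
    (hba : b ≤ a) (hcκ : c ≤ card (V κ)) (hF2 : 2 ≤ #F)
    (heq : c * (a + b - 1) * prob (fun t ↦ 2 ≤ ecount F t) = #F - 1) :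
    card (V κ) = c ∧ (b - card (V κ) : ℚ) * (#(away F κ) - 1) = 0 := by
  have hR := prob_two_le_ecount_le (hF.away κ) haway h.sizesAtLeast_away (hb.trans hba) hba le_rfl
  have hsum := mul_card_mul_prob_two_le_ecount_le hF h hb hba hR
  have hlt : (#(away F κ) : ℚ) < #F := mod_cast card_away_lt hu₀
  have hone : (1 : ℚ) ≤ #(away F κ) := mod_cast haway.card_pos
  have hF2' : (2 : ℚ) ≤ #F := mod_cast hF2
  have hb' : (1 : ℚ) ≤ b := mod_cast hb
  have hba' : (b : ℚ) ≤ a := mod_cast hba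
  have hcb' : (c : ℚ) ≤ b := mod_cast hcb
  have hcκ' : (c : ℚ) ≤ card (V κ) := mod_cast hcκ
  rw [mul_assoc] at heq hsum
  set X : ℚ := (a + b - 1) * prob (fun t ↦ 2 ≤ ecount F t)
  have hX : 0 < X := by
    refine pos_of_mul_pos_right (a := (c : ℚ)) (by linarith) (Nat.cast_nonneg c)
  have hκb : (card (V κ) : ℚ) ≤ b := by
    by_contra! hlt'
    nlinarith [mul_pos (sub_pos.2 hlt') (sub_pos.2 hlt), mul_nonneg (card (V κ)).cast_nonneg hX.le,
      mul_le_mul_of_nonneg_right hcb' (mul_nonneg (card (V κ)).cast_nonneg hX.le)]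
  have hslack : 0 ≤ (b - card (V κ) : ℚ) * (#(away F κ) - 1) :=
    mul_nonneg (by linarith) (by linarith)
  have hκc : (card (V κ) : ℚ) ≤ c := by
    refine le_of_mul_le_mul_right ?_ hX
    nlinarith
  obtain rfl : card (V κ) = c := le_antisymm (mod_cast hκc) hcκ
  exact ⟨rfl, by nlinarith⟩

theorem isFullStar_of_prob_two_le_ecount_eq (hF : Crossing F) (hs : SizesAtLeast F c b a)
    (hb : 2 ≤ b) (hcb : c ≤ b) (hba : b ≤ a) (hF2 : 2 ≤ #F)
    (heq : c * (a + b - 1) * prob (fun t ↦ 2 ≤ ecount F t) = #F - 1) :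
    IsFullStar F c (a + b) := by
  obtain ⟨κ, l, h, hcκ, u₀, hu₀⟩ := hs.exists_starAt_nonempty (card_pos.1 (by omega)) hba
  rcases (away F κ).eq_empty_or_nonempty with haway | haway
  · have hle := card_mul_prob_two_le_ecount_le_of_away_eq_empty hF h hu₀ haway
    have hF2' : (2 : ℚ) ≤ #F := mod_cast hF2
    obtain rfl : card (V κ) = c := by
      refine le_antisymm (Nat.cast_le.1 (le_of_mul_le_mul_right (a := (a + b - 1 : ℚ) *
        prob fun t ↦ 2 ≤ ecount F t) ?_ ?_)) hcκ
      · rw [← mul_assoc, ← mul_assoc]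
        exact hle.trans_eq heq.symm
      · exact pos_of_mul_pos_right (a := (c : ℚ)) (by linarith) (Nat.cast_nonneg c)
    exact isFullStar_of_away_eq_empty hF h hu₀ haway hb hF2 heq
  · have hb1 : 1 ≤ b := by omega
    obtain ⟨rfl, hslack⟩ := card_eq_of_prob_two_le_ecount_eq hF h hu₀ haway hb1 hcb hba hcκ hF2 heq
    have hR := prob_two_le_ecount_le (hF.away κ) haway h.sizesAtLeast_away (hb1.trans hba) hba
      le_rfl
    have hfiber := mul_card_mul_prob_two_le_ecount hF κ b (a + b - 1)
    rw [heq, ← sub_zero (b * (#F - 1) : ℚ), ← hslack, ← sum_mul_card_starAt_add hF, eq_comm,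
      sum_eq_sum_iff_of_le fun u _ ↦
        prob_two_le_vcount_starAt_add_ecount_away_le hF h hb1 hba hR u] at hfiber
    obtain ⟨hRa, hstar⟩ := isFullStar_of_prob_two_le_vcount_starAt_add_ecount_away_eq hF h hu₀ hb
      hba fun u ↦ hfiber u (mem_univ u)
    have : (2 : ℚ) ≤ a := mod_cast hb.trans hba
    rw [hRa, mul_eq_zero, or_iff_left (by linarith), sub_eq_zero, Nat.cast_inj] at hslack
    rw [← hslack, add_comm] at hstar
    rwa [← hslack]

end ClassBound

section EdgeBound

variable {ι : Type*} {V : ι → Type*} {F : Finset (Sym2 (Σ i, V i))} {e e₀ : Sym2 (Σ i, V i)}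
  {v w : Σ i, V i} {t : ∀ i, V i} {m : ℕ}

open scoped Classical in
theorem ecount_erase_add [DecidableEq (Sym2 (Σ i, V i))] (he₀ : e₀ ∈ F) (t : ∀ i, V i) :
    ecount (F.erase e₀) t + (if Spans t e₀ then 1 else 0) = ecount F t := by
  simp only [ecount, card_filter]
  exact sum_erase_add _ _ he₀

variable [Fintype ι] [DecidableEq ι] [∀ i, Fintype (V i)] [∀ i, Nonempty (V i)]

theorem card_mul_card_eq_of_mul_expect_ecount_eq (hF : Crossing F) (hm : 0 < m)
    (hle : ∀ v w, s(v, w) ∈ F → m ≤ card (V v.1) * card (V w.1))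
    (heq : m * 𝔼 t, (ecount F t : ℚ) = #F) (he : s(v, w) ∈ F) :
    card (V v.1) * card (V w.1) = m := by
  have hle_one : ∀ e ∈ F, m * prob (fun t ↦ Spans t e) ≤ 1 := fun e ↦ e.ind fun v w he ↦ by
    rw [prob_spans (hF he)]
    exact mul_inv_le_one_of_le₀ (mod_cast hle v w he) (by positivity)
  rw [expect_ecount, mul_sum, card_eq_sum_ones, Nat.cast_sum, Nat.cast_one,
    sum_eq_sum_iff_of_le hle_one] at heq
  have hone := heq _ he
  rw [prob_spans (hF he), mul_inv_eq_one₀ (mod_cast (hm.trans_le (hle v w he)).ne')] at hone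
  exact_mod_cast hone.symm

variable (hF : Crossing F) (he₀ : e₀ ∈ F) (hm : 0 < m)
  (hle : ∀ v w, s(v, w) ∈ F → s(v, w) ≠ e₀ → m ≤ card (V v.1) * card (V w.1))
  (heq : m * prob (fun t ↦ 2 ≤ ecount F t) = #F - 1)

include hF he₀ hm hle heq

open scoped Classical in
theorem ecount_erase_eq_of_mul_prob_two_le_ecount_eq (t : ∀ i, V i) :
    ecount (F.erase e₀) t = if 2 ≤ ecount F t then 1 else 0 := by
  convert eq_ite_of_expect_le_prob (p := fun t ↦ 2 ≤ ecount F t) (fun t ht ↦ ?_) ?_ t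
  · beta_reduce at ht
    have := ecount_erase_add he₀ t
    split_ifs at this <;> omega
  · refine le_of_mul_le_mul_left (a := (m : ℚ)) ?_ (mod_cast hm)
    rw [heq, ← Nat.cast_pred (card_pos.2 ⟨_, he₀⟩), ← card_erase_of_mem he₀]
    exact mul_expect_ecount_le (fun v w h ↦ hF (mem_of_mem_erase h)) fun v w h ↦
      hle v w (mem_of_mem_erase h) (ne_of_mem_erase h)

theorem card_mul_card_eq_of_mul_prob_two_le_ecount_eq (he : s(v, w) ∈ F) (hne : s(v, w) ≠ e₀) :
    card (V v.1) * card (V w.1) = m := by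
  classical
  refine card_mul_card_eq_of_mul_expect_ecount_eq (F := F.erase e₀)
    (fun v w h ↦ hF (mem_of_mem_erase h)) hm
    (fun v w h ↦ hle v w (mem_of_mem_erase h) (ne_of_mem_erase h)) ?_ (mem_erase.2 ⟨hne, he⟩)
  rw [card_erase_of_mem he₀, Nat.cast_pred (card_pos.2 ⟨_, he₀⟩), ← heq, prob]
  congr! 3 with t
  rw [ecount_erase_eq_of_mul_prob_two_le_ecount_eq hF he₀ hm hle heq t]
  split_ifs <;> simp

open scoped Classical in
theorem ecount_erase_le_one (t : ∀ i, V i) : ecount (F.erase e₀) t ≤ 1 := by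
  rw [ecount_erase_eq_of_mul_prob_two_le_ecount_eq hF he₀ hm hle heq t]
  split_ifs <;> omega

theorem spans_of_spans_of_mul_prob_two_le_ecount_eq (he : e ∈ F) (ht : Spans t e) :
    Spans t e₀ := by
  classical
  by_contra hcon
  have herase := ecount_erase_add he₀ t
  have hone := ecount_erase_eq_of_mul_prob_two_le_ecount_eq hF he₀ hm hle heq t
  have hpos := one_le_ecount.2 ⟨e, he, ht⟩
  rw [if_neg hcon] at herase
  split_ifs at hone <;> omega

end EdgeBound

section UnitParts

variable {ι : Type*} {V : ι → Type*} {F : Finset (Sym2 (Σ i, V i))} {v w X Y p q : Σ i, V i}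
  {e : Sym2 (Σ i, V i)}

/-- The edge `e` joins the vertex `p` to one of the vertices `X` and `Y`. -/
def IsSpoke (X Y p : Σ i, V i) (e : Sym2 (Σ i, V i)) : Prop := e = s(X, p) ∨ e = s(Y, p)

theorem IsSpoke.eq (hp : IsSpoke X Y p e) (hq : IsSpoke X Y q e) (hX : q.1 ≠ X.1)
    (hY : q.1 ≠ Y.1) : p = q := by
  have hX' : q ≠ X := fun h ↦ hX (congrArg _ h)
  have hY' : q ≠ Y := fun h ↦ hY (congrArg _ h)
  rcases hp with rfl | rfl <;> rcases hq with h | h <;> rw [Sym2.eq_iff] at h <;> grind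

variable [∀ i, Fintype (V i)]

theorem apply_eq_of_card_eq_one (hX : card (V X.1) = 1) (t : ∀ i, V i) : t X.1 = X.2 :=
  have := Fintype.card_le_one_iff_subsingleton.1 hX.le
  Subsingleton.elim _ _

theorem eq_of_card_eq_one (hX : card (V X.1) = 1) (hv : v.1 = X.1) : v = X := by
  obtain ⟨i, x⟩ := v
  obtain rfl : i = X.1 := hv
  have := Fintype.card_le_one_iff_subsingleton.1 hX.le
  exact Sigma.ext rfl (heq_of_eq (Subsingleton.elim _ _))

theorem card_eq_two_of_prob_two_le_ecount_eq [Fintype ι] [DecidableEq ι] [∀ i, Nonempty (V i)]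
    (hF2 : 2 ≤ #F) (heq : prob (fun t ↦ 2 ≤ ecount F t) = #F - 1) :
    #F = 2 ∧ ∀ t, ∀ e ∈ F, Spans t e := by
  classical
  have hle := heq.symm.trans_le prob_le_one
  have hF : #F = 2 := le_antisymm (by rw [← Nat.cast_le (α := ℚ)]; push_cast; linarith) hF2
  refine ⟨hF, fun t ↦ filter_eq_self.1 (eq_of_subset_of_card_le (filter_subset _ F) ?_)⟩
  exact hF.trans_le (forall_of_one_le_prob (by rw [heq, hF]; norm_num) t)

theorem card_eq_one_of_forall_spans [∀ i, Nonempty (V i)] (h : ∀ t, Spans t e) (hv : v ∈ e) :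
    card (V v.1) = 1 := by
  classical
  refine Fintype.card_eq_one_iff.2 ⟨v.2, fun x ↦ ?_⟩
  simpa using h (Function.update (fun _ ↦ Classical.arbitrary _) v.1 x) v hv

end UnitParts

section BookClass

variable {ι : Type*} {V : ι → Type*} {F : Finset (Sym2 (Σ i, V i))} {v w X Y p : Σ i, V i}
  {e f : Sym2 (Σ i, V i)} {t : ∀ i, V i} {r : ι} {a : ℕ}

/-- A color class living on the book whose spine is `X Y` and whose pages are the vertices of the
part `r`: either it contains the spine and at most one edge to each page, or it consists of the two
edges to a single page. -/
def IsBookClass (X Y : Σ i, V i) (r : ι) (F : Finset (Sym2 (Σ i, V i))) : Prop :=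
  (∀ e ∈ F, e = s(X, Y) ∨ ∃ x : V r, IsSpoke X Y ⟨r, x⟩ e) ∧
    ((s(X, Y) ∈ F ∧ ∀ x : V r, s(X, ⟨r, x⟩) ∈ F → s(Y, ⟨r, x⟩) ∉ F) ∨
      ∃ x : V r, ∀ e, e ∈ F ↔ IsSpoke X Y ⟨r, x⟩ e)

theorem IsSpoke.eq_of_ne {g : Sym2 (Σ i, V i)} (he : IsSpoke X Y p e) (hf : IsSpoke X Y p f)
    (hg : IsSpoke X Y p g) (hef : e ≠ f) : g = e ∨ g = f := by
  rcases he with rfl | rfl <;> rcases hf with rfl | rfl <;> rcases hg with rfl | rfl <;>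
    first | exact .inl rfl | exact .inr rfl | exact absurd rfl hef

theorem IsBookClass.notMem_of_mem (hF : IsBookClass X Y r F) (hrX : r ≠ X.1) (hrY : r ≠ Y.1)
    {x : V r} (hspine : s(X, Y) ∈ F) (hx : s(X, ⟨r, x⟩) ∈ F) : s(Y, ⟨r, x⟩) ∉ F := by
  rcases hF.2 with ⟨-, h⟩ | ⟨y, h⟩
  · exact h x hx
  · rcases (h _).1 hspine with h | h <;> grind

theorem IsBookClass.eq_of_isSpoke (hF : IsBookClass X Y r F) (hrX : r ≠ X.1) (hrY : r ≠ Y.1)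
    {x y : V r} (hspine : s(X, Y) ∉ F) (he : e ∈ F) (hf : f ∈ F) (hx : IsSpoke X Y ⟨r, x⟩ e)
    (hy : IsSpoke X Y ⟨r, y⟩ f) : x = y := by
  obtain ⟨z, hz⟩ := hF.2.resolve_left fun h ↦ hspine h.1
  have hxz := hx.eq ((hz e).1 he) hrX hrY
  have hyz := hy.eq ((hz f).1 hf) hrX hrY
  exact eq_of_heq (Sigma.mk.inj (hxz.trans hyz.symm)).2

variable [∀ i, Fintype (V i)] (hX : card (V X.1) = 1) (hY : card (V Y.1) = 1)

include hX hY

theorem spans_spine (t : ∀ i, V i) : Spans t s(X, Y) :=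
  spans_mk.2 ⟨apply_eq_of_card_eq_one hX t, apply_eq_of_card_eq_one hY t⟩

theorem IsSpoke.spans_iff (he : IsSpoke X Y p e) : Spans t e ↔ t p.1 = p.2 := by
  rcases he with rfl | rfl <;>
    simp [apply_eq_of_card_eq_one hX, apply_eq_of_card_eq_one hY]

theorem IsBookClass.exists_forall_two_le_ecount (hF : IsBookClass X Y r F) (hF2 : 2 ≤ #F) :
    ∃ x, ∀ t, t r = x → 2 ≤ ecount F t := by
  rcases hF.2 with ⟨hspine, -⟩ | ⟨x, hx⟩
  · obtain ⟨e, he, hne⟩ := exists_mem_ne hF2 s(X, Y)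
    obtain ⟨x, hx⟩ := (hF.1 e he).resolve_left hne
    exact ⟨x, fun t ht ↦ two_le_ecount.2
      ⟨e, he, _, hspine, hne, (hx.spans_iff hX hY).2 ht, spans_spine hX hY t⟩⟩
  · obtain ⟨e, he, f, hf, hef⟩ := one_lt_card.1 hF2
    exact ⟨x, fun t ht ↦ two_le_ecount.2 ⟨e, he, f, hf, hef,
      (((hx e).1 he).spans_iff hX hY).2 ht, (((hx f).1 hf).spans_iff hX hY).2 ht⟩⟩

variable (hI : ∀ i, i ≠ X.1 → i ≠ Y.1 → a ≤ card (V i))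

include hI

theorem le_card_mul_card_of_ne [∀ i, Nonempty (V i)] (hvw : v.1 ≠ w.1)
    (hne : s(v, w) ≠ s(X, Y)) : a ≤ card (V v.1) * card (V w.1) := by
  by_cases hv : v.1 ≠ X.1 ∧ v.1 ≠ Y.1
  · exact (hI _ hv.1 hv.2).trans (Nat.le_mul_of_pos_right _ Fintype.card_pos)
  by_cases hw : w.1 ≠ X.1 ∧ w.1 ≠ Y.1
  · exact (hI _ hw.1 hw.2).trans (Nat.le_mul_of_pos_left _ Fintype.card_pos)
  have hmem : ∀ u : Σ i, V i, ¬ (u.1 ≠ X.1 ∧ u.1 ≠ Y.1) → u = X ∨ u = Y := fun u hu ↦ by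
    rw [← not_or, not_not] at hu
    exact hu.imp (eq_of_card_eq_one hX) (eq_of_card_eq_one hY)
  rcases hmem v hv with rfl | rfl <;> rcases hmem w hw with rfl | rfl
  exacts [absurd rfl hvw, absurd rfl hne, absurd Sym2.eq_swap hne, absurd rfl hvw]

theorem exists_isSpoke_of_card_mul_card_eq (ha : 2 ≤ a) (h : card (V v.1) * card (V w.1) = a) :
    ∃ p : Σ i, V i, p.1 ≠ X.1 ∧ p.1 ≠ Y.1 ∧ card (V p.1) = a ∧ IsSpoke X Y p s(v, w) := by
  wlog hv : v.1 = X.1 ∨ v.1 = Y.1 generalizing v w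
  · rw [not_or] at hv
    by_cases hw : w.1 = X.1 ∨ w.1 = Y.1
    · rw [Sym2.eq_swap]
      exact this (mul_comm _ _ |>.trans h) hw
    · rw [not_or] at hw
      nlinarith [hI _ hv.1 hv.2, hI _ hw.1 hw.2]
  have hv1 : card (V v.1) = 1 := by rcases hv with hv | hv <;> rwa [hv]
  rw [hv1, one_mul] at h
  refine ⟨w, fun hw ↦ ?_, fun hw ↦ ?_, h, ?_⟩
  · rw [hw, hX] at h
    omega
  · rw [hw, hY] at h
    omega
  · exact hv.imp (fun hv ↦ by rw [eq_of_card_eq_one hX hv]) fun hv ↦ by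
      rw [eq_of_card_eq_one hY hv]

variable [Fintype ι] [DecidableEq ι] [∀ i, Nonempty (V i)] (ha : 2 ≤ a) (hF : Crossing F)
  (hF2 : 2 ≤ #F) (heq : a * prob (fun t ↦ 2 ≤ ecount F t) = #F - 1)

include ha hF hF2 heq

theorem isBookClass_of_spine_mem (hXY : s(X, Y) ∈ F) :
    ∃ r, r ≠ X.1 ∧ r ≠ Y.1 ∧ card (V r) = a ∧ IsBookClass X Y r F := by
  classical
  have hle : ∀ v w, s(v, w) ∈ F → s(v, w) ≠ s(X, Y) → a ≤ card (V v.1) * card (V w.1) :=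
    fun v w h ↦ le_card_mul_card_of_ne hX hY hI (hF h)
  have hspoke : ∀ e ∈ F, e ≠ s(X, Y) →
      ∃ p : Σ i, V i, p.1 ≠ X.1 ∧ p.1 ≠ Y.1 ∧ card (V p.1) = a ∧ IsSpoke X Y p e :=
    fun e ↦ e.ind fun v w he hne ↦ exists_isSpoke_of_card_mul_card_eq hX hY hI ha
      (card_mul_card_eq_of_mul_prob_two_le_ecount_eq hF hXY (by omega) hle heq he hne)
  have huniq : ∀ e ∈ F, ∀ f ∈ F, e ≠ s(X, Y) → f ≠ s(X, Y) →
      ∀ t, Spans t e → Spans t f → e = f := by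
    intro e he f hf hne hnf t hte htf
    by_contra hef
    have := ecount_erase_le_one hF hXY (by omega) hle heq t
    have : 2 ≤ ecount (F.erase s(X, Y)) t := two_le_ecount.2
      ⟨e, mem_erase.2 ⟨hne, he⟩, f, mem_erase.2 ⟨hnf, hf⟩, hef, hte, htf⟩
    omega
  obtain ⟨e₁, he₁, hne₁⟩ := exists_mem_ne hF2 s(X, Y)
  obtain ⟨p, hpX, hpY, hpa, hp⟩ := hspoke e₁ he₁ hne₁
  refine ⟨p.1, hpX, hpY, hpa, fun e he ↦ ?_, .inl ⟨hXY, fun x hx hy ↦ ?_⟩⟩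
  · refine or_iff_not_imp_left.2 fun hne ↦ ?_
    obtain ⟨q, hqX, hqY, -, hq⟩ := hspoke e he hne
    have hqp : q.1 = p.1 := by
      by_contra hqp
      obtain ⟨t, htq, htp⟩ := exists_transversal_of_ne hqp
      obtain rfl := huniq e he e₁ he₁ hne hne₁ t ((hq.spans_iff hX hY).2 htq)
        ((hp.spans_iff hX hY).2 htp)
      exact hqp (congrArg _ (hq.eq hp hpX hpY))
    obtain ⟨i, x⟩ := q
    obtain rfl : i = p.1 := hqp
    exact ⟨x, hq⟩
  · have hne : ∀ v, s(v, ⟨p.1, x⟩) ≠ s(X, Y) := fun v h ↦ by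
      have := h ▸ Sym2.mem_mk_right v ⟨p.1, x⟩
      rcases Sym2.mem_iff.1 this with h | h
      exacts [hpX (congrArg Sigma.fst h :), hpY (congrArg Sigma.fst h :)]
    have hxy : s(X, ⟨p.1, x⟩) = s(Y, ⟨p.1, x⟩) := huniq _ hx _ hy (hne X) (hne Y)
      (Function.update (fun _ ↦ Classical.arbitrary _) p.1 x)
      ((IsSpoke.spans_iff hX hY (.inl rfl)).2 (Function.update_self ..))
      ((IsSpoke.spans_iff hX hY (.inr rfl)).2 (Function.update_self ..))
    exact hF hXY (congrArg _ (Sym2.congr_left.1 hxy))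

theorem isBookClass_of_spine_notMem (hXY : s(X, Y) ∉ F) :
    ∃ r, r ≠ X.1 ∧ r ≠ Y.1 ∧ card (V r) = a ∧ IsBookClass X Y r F := by
  have hle : ∀ v w, s(v, w) ∈ F → a ≤ card (V v.1) * card (V w.1) :=
    fun v w h ↦ le_card_mul_card_of_ne hX hY hI (hF h) (ne_of_mem_of_not_mem h hXY)
  have hspoke : ∀ e ∈ F,
      ∃ p : Σ i, V i, p.1 ≠ X.1 ∧ p.1 ≠ Y.1 ∧ card (V p.1) = a ∧ IsSpoke X Y p e := by
    intro e he
    obtain ⟨f, hf, hfe⟩ := exists_mem_ne hF2 e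
    induction e with | _ v w
    exact exists_isSpoke_of_card_mul_card_eq hX hY hI ha
      (card_mul_card_eq_of_mul_prob_two_le_ecount_eq hF hf (by omega) (fun v w h _ ↦ hle v w h)
        heq he hfe.symm)
  obtain ⟨e, he, f, hf, hef⟩ := one_lt_card.1 hF2
  obtain ⟨p, hpX, hpY, hpa, hp⟩ := hspoke e he
  have : Nontrivial (V p.1) := Fintype.one_lt_card_iff_nontrivial.1 (by omega)
  have hall : ∀ g ∈ F, IsSpoke X Y p g := by
    intro g hg
    obtain ⟨q, -, -, -, hq⟩ := hspoke g hg
    have hpg : p ∈ g := mem_of_forall_spans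
      ⟨_, (hq.spans_iff hX hY).2 (Function.update_self q.1 q.2 fun _ ↦ Classical.arbitrary _)⟩
      fun t ht ↦ (hp.spans_iff hX hY).1 <| spans_of_spans_of_mul_prob_two_le_ecount_eq hF he
        (by omega) (fun v w h _ ↦ hle v w h) heq hg ht
    have hqp : p = q := by
      rcases hq with rfl | rfl <;> rcases Sym2.mem_iff.1 hpg with h | h
      exacts [absurd (congrArg _ h) hpX, h, absurd (congrArg _ h) hpY, h]
    exact hqp ▸ hq
  exact ⟨p.1, hpX, hpY, hpa, fun g hg ↦ .inr ⟨p.2, hall g hg⟩, .inr ⟨p.2, fun g ↦ ⟨hall g, fun hg ↦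
    ((hall e he).eq_of_ne (hall f hf) hg hef).elim (· ▸ he) (· ▸ hf)⟩⟩⟩

theorem exists_isBookClass_of_prob_two_le_ecount_eq :
    ∃ r, r ≠ X.1 ∧ r ≠ Y.1 ∧ card (V r) = a ∧ IsBookClass X Y r F := by
  by_cases hXY : s(X, Y) ∈ F
  · exact isBookClass_of_spine_mem hX hY hI ha hF hF2 heq hXY
  · exact isBookClass_of_spine_notMem hX hY hI ha hF hF2 heq hXY

end BookClass

section NumColors

variable {W : Type} {G : SimpleGraph W} {c : G.EdgeLabeling ℕ}

variable [Finite W]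

theorem numColors_le_card_edgeSet (c : G.EdgeLabeling ℕ) : numColors c ≤ Nat.card G.edgeSet :=
  Finite.card_range_le (fun e ↦ c e)

theorem card_edgeSet_le_numColors_add {D : Finset (Sym2 W)}
    (h : ∀ e f : G.edgeSet, (e : Sym2 W) ∉ D → (f : Sym2 W) ∉ D → c e = c f → e = f) :
    Nat.card G.edgeSet ≤ numColors c + #D := by
  let K : Set G.edgeSet := {e | (e : Sym2 W) ∉ D}
  have hK : K.ncard ≤ numColors c := Set.ncard_le_ncard_of_injOn c
    (fun e _ ↦ Set.mem_range_self e) (fun e he f hf ↦ h e f he hf) (Set.finite_range c)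
  have hKc : Kᶜ.ncard ≤ #D := by
    rw [← Set.ncard_coe_finset]
    exact Set.ncard_le_ncard_of_injOn _ (fun e he ↦ not_not.1 he) Subtype.val_injective.injOn
  rw [← Set.ncard_add_ncard_compl K]
  exact add_le_add hK hKc

theorem le_ar {U : Type} {H : SimpleGraph U} (hc : ¬ HasRainbow c H) : numColors c ≤ ar G H :=
  le_csSup ⟨Nat.card G.edgeSet, by rintro _ ⟨d, -, rfl⟩; exact numColors_le_card_edgeSet d⟩
    ⟨c, hc, rfl⟩

end NumColors

section ColorClasses

variable {W : Type} [Fintype W] {G : SimpleGraph W} {c : G.EdgeLabeling ℕ} {a : ℕ}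

open scoped Classical in
/-- The edges of color `a`. -/
noncomputable def colorClass (c : G.EdgeLabeling ℕ) (a : ℕ) : Finset (Sym2 W) :=
  {e | ∃ h : e ∈ G.edgeSet, c ⟨e, h⟩ = a}

/-- The colors used by a coloring. -/
noncomputable def colors (c : G.EdgeLabeling ℕ) : Finset ℕ := (Set.finite_range c).toFinset

theorem mem_colorClass {e : Sym2 W} :
    e ∈ colorClass c a ↔ ∃ h : e ∈ G.edgeSet, c ⟨e, h⟩ = a := by simp [colorClass]

theorem coe_mem_colorClass {e : G.edgeSet} : (e : Sym2 W) ∈ colorClass c a ↔ c e = a :=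
  mem_colorClass.trans ⟨fun ⟨_, h⟩ ↦ h, fun h ↦ ⟨e.2, h⟩⟩

theorem mem_colors : a ∈ colors c ↔ ∃ e, c e = a := (Set.finite_range c).mem_toFinset

theorem apply_mem_colors (e : G.edgeSet) : c e ∈ colors c := mem_colors.2 ⟨e, rfl⟩

theorem card_colors (c : G.EdgeLabeling ℕ) : #(colors c) = numColors c :=
  (Set.ncard_eq_toFinset_card _ _).symm

theorem colorClass_nonempty (ha : a ∈ colors c) : (colorClass c a).Nonempty :=
  let ⟨e, he⟩ := mem_colors.1 ha
  ⟨e, coe_mem_colorClass.2 he⟩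

theorem sum_card_colorClass (c : G.EdgeLabeling ℕ) :
    ∑ a ∈ colors c, #(colorClass c a) = Nat.card G.edgeSet := by
  classical
  rw [Nat.card_eq_fintype_card, ← card_univ,
    card_eq_sum_card_fiberwise (f := c) (t := colors c) fun e _ ↦ apply_mem_colors e]
  refine sum_congr rfl fun a _ ↦ ?_
  rw [← card_map (Function.Embedding.subtype _)]
  congr 1
  ext e
  simp [mem_colorClass]

end ColorClasses

section Counting

variable {ι : Type} {V : ι → Type} {v w : Σ i, V i}

theorem completeMultipartiteGraph_adj_iff :
    (completeMultipartiteGraph V).Adj v w ↔ v.1 ≠ w.1 := by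
  simp [completeMultipartiteGraph]

/-- The copy of the complete graph on the vertices of a transversal. -/
def transversalCopy (t : ∀ i, V i) : Copy (completeGraph ι) (completeMultipartiteGraph V) where
  toHom := ⟨fun i ↦ ⟨i, t i⟩, fun h ↦ completeMultipartiteGraph_adj_iff.2 h⟩
  injective' _ _ h := congrArg Sigma.fst h

theorem spans_transversalCopy (t : ∀ i, V i) (e : (completeGraph ι).edgeSet) :
    Spans t ((transversalCopy t).mapEdgeSet e : Sym2 (Σ i, V i)) := by
  rintro v hv
  obtain ⟨i, -, rfl⟩ := Sym2.mem_map.1 hv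
  rfl

variable [Fintype ι] [∀ i, Fintype (V i)] {c : (completeMultipartiteGraph V).EdgeLabeling ℕ}

theorem crossing_colorClass (c : (completeMultipartiteGraph V).EdgeLabeling ℕ) (a : ℕ) :
    Crossing (colorClass c a) := fun _ _ h ↦
  completeMultipartiteGraph_adj_iff.1 (mem_colorClass.1 h).1

theorem exists_two_le_ecount_colorClass (hc : ¬ HasRainbow c (completeGraph ι)) (t : ∀ i, V i) :
    ∃ a ∈ colors c, 2 ≤ ecount (colorClass c a) t := by
  contrapose! hc
  refine ⟨transversalCopy t, fun e f hef ↦ ?_⟩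
  by_contra hne
  refine (hc _ (apply_mem_colors ((transversalCopy t).mapEdgeSet e))).not_ge (two_le_ecount.2
    ⟨_, coe_mem_colorClass.2 rfl, _, coe_mem_colorClass.2 hef.symm, fun h ↦ hne ?_,
      spans_transversalCopy t e, spans_transversalCopy t f⟩)
  exact (transversalCopy t).mapEdgeSet.injective (Subtype.ext h)

variable [DecidableEq ι]

/-- The averaging argument with constant `N` is tight for the coloring `c`: every color class
attains the bound `N * P ≤ |F| - 1`, where `P` is the probability that a random transversal spans
two of its edges, and no transversal spans two edges of each of two color classes. -/
def IsTight (c : (completeMultipartiteGraph V).EdgeLabeling ℕ) (N : ℕ) : Prop :=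
  (∀ a ∈ colors c, N * prob (fun t ↦ 2 ≤ ecount (colorClass c a) t) = #(colorClass c a) - 1) ∧
    ∀ t, ∀ a ∈ colors c, ∀ b ∈ colors c, 2 ≤ ecount (colorClass c a) t →
      2 ≤ ecount (colorClass c b) t → a = b

theorem isTight_of_bound [∀ i, Nonempty (V i)] (hc : ¬ HasRainbow c (completeGraph ι)) {N : ℕ}
    (hN : 0 < N) (hbound : ∀ a ∈ colors c,
      N * prob (fun t ↦ 2 ≤ ecount (colorClass c a) t) ≤ #(colorClass c a) - 1)
    (hnum : Nat.card (completeMultipartiteGraph V).edgeSet ≤ numColors c + N) : IsTight c N := by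
  have hcover := exists_two_le_ecount_colorClass hc
  have hsum : ∑ a ∈ colors c, ((#(colorClass c a) : ℚ) - 1) ≤ N := by
    rw [sum_sub_distrib, ← Nat.cast_sum, sum_card_colorClass, ← Nat.cast_one, ← Nat.cast_sum,
      ← card_eq_sum_ones, card_colors, sub_le_iff_le_add']
    exact_mod_cast hnum
  have hle := sum_le_sum hbound
  rw [← mul_sum] at hle
  have hone : ∑ a ∈ colors c, prob (fun t ↦ 2 ≤ ecount (colorClass c a) t) = 1 :=
    (one_le_sum_prob hcover).antisymm' <|
      le_of_mul_le_mul_left (by linarith) (Nat.cast_pos.2 hN : (0 : ℚ) < N)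
  refine ⟨(sum_eq_sum_iff_of_le hbound).1 ?_, fun t a ha b hb ↦
    eq_of_sum_prob_le_one hcover hone.le ha hb⟩
  rw [hone] at hle
  rw [← mul_sum, hone]
  linarith

end Counting

section LowerBound

variable {ι : Type} {V : ι → Type} {κ i j : ι} {z u v : Σ i, V i}

open scoped Classical in
/-- The map on pairs of vertices that moves every edge between a vertex `u` of the part `κ` and the
parts `i` and `j` to the edge `u z`. Coloring the edges by their images merges the edges of each of
these stars, and destroys all rainbow copies of the complete graph. -/
noncomputable def mergeStars (hi : κ ≠ i) (hj : κ ≠ j) (z : Σ i, V i) :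
    Sym2 (Σ i, V i) → Sym2 (Σ i, V i) :=
  Sym2.lift ⟨fun v w ↦ if v.1 = κ ∧ (w.1 = i ∨ w.1 = j) then s(v, z)
    else if w.1 = κ ∧ (v.1 = i ∨ v.1 = j) then s(w, z) else s(v, w), fun v w ↦ by grind⟩

theorem mergeStars_mk (hi : κ ≠ i) (hj : κ ≠ j) (hu : u.1 = κ) (hv : v.1 = i ∨ v.1 = j) :
    mergeStars hi hj z s(u, v) = s(u, z) := by
  simp only [mergeStars, Sym2.lift_mk, hu, hv, and_self, if_true]

theorem mergeStars_of_forall_ne {e : Sym2 (Σ i, V i)} (hi : κ ≠ i) (hj : κ ≠ j)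
    (he : ∀ u v, u.1 = κ → (v.1 = i ∨ v.1 = j) → v ≠ z → e ≠ s(u, v)) :
    mergeStars hi hj z e = e := by
  induction e with | _ v w
  simp only [mergeStars, Sym2.lift_mk]
  split_ifs with h h
  · by_cases hw : w = z
    · rw [hw]
    · exact absurd rfl (he v w h.1 h.2 hw)
  · by_cases hv : v = z
    · rw [hv, Sym2.eq_swap]
    · exact absurd Sym2.eq_swap (he w v h.1 h.2 hv)
  · rfl

variable [Finite ι]

theorem exists_apply_fst_eq (f : Copy (completeGraph ι) (completeMultipartiteGraph V)) (i : ι) :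
    ∃ x, (f x).1 = i := by
  refine Finite.injective_iff_surjective.1 (fun x y hxy ↦ ?_) i
  by_contra hne
  exact completeMultipartiteGraph_adj_iff.1 (f.toHom.map_adj ((top_adj _ _).2 hne)) hxy

theorem not_hasRainbow_of_eq_of_mergeStars_eq {c : (completeMultipartiteGraph V).EdgeLabeling ℕ}
    (hi : κ ≠ i) (hj : κ ≠ j) (hij : i ≠ j)
    (hc : ∀ e f : (completeMultipartiteGraph V).edgeSet,
      mergeStars hi hj z e = mergeStars hi hj z f → c e = c f) :
    ¬ HasRainbow c (completeGraph ι) := by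
  rintro ⟨f, hf⟩
  obtain ⟨x, rfl⟩ := exists_apply_fst_eq f κ
  obtain ⟨y, rfl⟩ := exists_apply_fst_eq f i
  obtain ⟨w, rfl⟩ := exists_apply_fst_eq f j
  have hxy : x ≠ y := fun h ↦ hi (by rw [h])
  have hxw : x ≠ w := fun h ↦ hj (by rw [h])
  have heq := @hf ⟨s(x, y), by simpa using hxy⟩ ⟨s(x, w), by simpa using hxw⟩ <| hc _ _ <|
    (mergeStars_mk hi hj rfl (.inl rfl)).trans (mergeStars_mk hi hj rfl (.inr rfl)).symm
  rw [Subtype.mk.injEq, Sym2.congr_right] at heq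
  exact hij (by rw [heq])

variable [∀ i, Fintype (V i)] [∀ i, Nonempty (V i)] (hi : κ ≠ i) (hj : κ ≠ j) (hij : i ≠ j)

include hi hj hij

theorem exists_not_hasRainbow :
    ∃ c : (completeMultipartiteGraph V).EdgeLabeling ℕ, ¬ HasRainbow c (completeGraph ι) ∧
      Nat.card (completeMultipartiteGraph V).edgeSet ≤
        numColors c + card (V κ) * (card (V i) + card (V j) - 1) := by
  classical
  let z : Σ i, V i := ⟨i, Classical.arbitrary _⟩
  let code := Finite.equivFin (Sym2 (Σ i, V i))
  let L : Finset (Σ i, V i) := (part i ∪ part j).erase z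
  let D : Finset (Sym2 (Σ i, V i)) := (part κ ×ˢ L).image fun p ↦ s(p.1, p.2)
  have hL : #L = card (V i) + card (V j) - 1 := by
    rw [card_erase_of_mem (by simp [z, mem_part]), card_union_of_disjoint, card_part, card_part]
    exact disjoint_left.2 fun v hvi hvj ↦ hij ((mem_part.1 hvi).symm.trans (mem_part.1 hvj))
  have hfix : ∀ e ∉ D, mergeStars hi hj z e = e := fun e he ↦
    mergeStars_of_forall_ne hi hj fun u v hu hv hvz h ↦ he <| mem_image.2 ⟨(u, v), by
      simpa [D, L, mem_part, hu, hvz] using hv, h.symm⟩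
  let c : (completeMultipartiteGraph V).EdgeLabeling ℕ := fun e ↦ code (mergeStars hi hj z e)
  have hc : ∀ e f : (completeMultipartiteGraph V).edgeSet, c e = c f ↔
      mergeStars hi hj z e = mergeStars hi hj z f := fun e f ↦
    Fin.val_inj.trans code.injective.eq_iff
  have hcard : Nat.card (completeMultipartiteGraph V).edgeSet ≤ numColors c + #D :=
    card_edgeSet_le_numColors_add fun e f he hf h ↦ Subtype.ext <| by
      rwa [hc, hfix _ he, hfix _ hf] at h
  have hD : #D ≤ card (V κ) * (card (V i) + card (V j) - 1) := by
    rw [← hL, ← card_part κ, ← card_product]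
    exact card_image_le
  exact ⟨c, not_hasRainbow_of_eq_of_mergeStars_eq hi hj hij fun e f ↦ (hc e f).2,
    hcard.trans (Nat.add_le_add_left hD _)⟩

theorem card_edgeSet_le_of_isExtremal {c : (completeMultipartiteGraph V).EdgeLabeling ℕ}
    (hc : IsExtremal c (completeGraph ι)) : Nat.card (completeMultipartiteGraph V).edgeSet ≤
      numColors c + card (V κ) * (card (V i) + card (V j) - 1) := by
  obtain ⟨d, hd, hle⟩ := exists_not_hasRainbow (V := V) hi hj hij
  exact hle.trans (Nat.add_le_add_right ((le_ar hd).trans_eq hc.2.symm) _)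

end LowerBound

section StarColorings

theorem exists_apply_eq {ι : Type*} {V : ι → Type*} [∀ i, Nonempty (V i)] (v : Σ i, V i) :
    ∃ t : ∀ i, V i, t v.1 = v.2 := by
  classical
  exact ⟨Function.update (fun _ ↦ Classical.arbitrary _) v.1 v.2, Function.update_self ..⟩

theorem exists_bijOn_of_existsUnique {ι α : Type*} {V : ι → Type*} [∀ i, Nonempty (V i)]
    {A : Set α} {y : α → Σ i, V i} (h : ∀ t : ∀ i, V i, ∃! a, a ∈ A ∧ t (y a).1 = (y a).2) :
    ∃ p, Set.BijOn y A {v | v.1 = p} := by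
  obtain ⟨a₀, ⟨ha₀, -⟩, -⟩ := h fun _ ↦ Classical.arbitrary _
  have hpart {a} (ha : a ∈ A) : (y a).1 = (y a₀).1 := by
    by_contra hne
    obtain ⟨t, hta, hta₀⟩ := exists_transversal_of_ne hne
    exact hne (by rw [(h t).unique ⟨ha, hta⟩ ⟨ha₀, hta₀⟩])
  refine ⟨(y a₀).1, fun a ha ↦ hpart ha, fun a ha b hb hab ↦ ?_, fun v hv ↦ ?_⟩
  · obtain ⟨t, ht⟩ := exists_apply_eq (y a)
    exact (h t).unique ⟨ha, ht⟩ ⟨hb, hab ▸ ht⟩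
  · obtain ⟨t, ht⟩ := exists_apply_eq v
    obtain ⟨a, ⟨ha, hta⟩, -⟩ := h t
    have hav : (y a).1 = v.1 := (hpart ha).trans hv.symm
    exact ⟨a, ha, Sigma.ext hav (by rw [← hta, ← ht, hav])⟩

theorem two_le_ecount_iff_of_mem_iff {ι : Type*} {V : ι → Type*} {F : Finset (Sym2 (Σ i, V i))}
    {y : Σ i, V i} {i j : ι} (hij : i ≠ j) (hF : ∀ e, e ∈ F ↔ e ∈ fullStar y i j) (t : ∀ i, V i) :
    2 ≤ ecount F t ↔ t y.1 = y.2 := by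
  rw [two_le_ecount]
  constructor
  · rintro ⟨e, he, -, -, -, hte, -⟩
    obtain ⟨w, -, rfl⟩ := (hF e).1 he
    exact (spans_mk.1 hte).1
  · refine fun ht ↦ ⟨s(y, ⟨i, t i⟩), (hF _).2 ⟨_, .inl rfl, rfl⟩, s(y, ⟨j, t j⟩),
      (hF _).2 ⟨_, .inr rfl, rfl⟩, fun h ↦ ?_, spans_mk.2 ⟨ht, rfl⟩, spans_mk.2 ⟨ht, rfl⟩⟩
    exact hij (congrArg Sigma.fst (Sym2.congr_right.1 h))

variable {ι : Type} {V : ι → Type} {c : (completeMultipartiteGraph V).EdgeLabeling ℕ} {m M N : ℕ}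
  {p : ι}

/-- To every vertex `u` of the partite set `p` there are assigned two other partite sets of total
size `M`, such that the edges from `u` to them have the same color; apart from that, all edges have
distinct colors. -/
def IsStarColoring [∀ i, Fintype (V i)] (c : (completeMultipartiteGraph V).EdgeLabeling ℕ) (p : ι)
    (M : ℕ) : Prop :=
  ∃ i j : V p → ι,
    (∀ u, i u ≠ j u ∧ p ≠ i u ∧ p ≠ j u ∧ card (V (i u)) + card (V (j u)) = M) ∧
    ∀ e f : (completeMultipartiteGraph V).edgeSet, c e = c f ↔ e = f ∨
      ∃ u, (e : Sym2 _) ∈ fullStar ⟨p, u⟩ (i u) (j u) ∧ (f : Sym2 _) ∈ fullStar ⟨p, u⟩ (i u) (j u)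

variable [Fintype ι] [∀ i, Fintype (V i)]

theorem two_le_card_colorClass {e f : (completeMultipartiteGraph V).edgeSet} (h : c e = c f)
    (hne : e ≠ f) : 2 ≤ #(colorClass c (c e)) :=
  one_lt_card.2 ⟨e, coe_mem_colorClass.2 rfl, f, coe_mem_colorClass.2 h.symm,
    Subtype.coe_injective.ne hne⟩

variable [DecidableEq ι] [∀ i, Nonempty (V i)]

theorem exists_isStarColoring (hc : ¬ HasRainbow c (completeGraph ι)) (hT : IsTight c N)
    (hstar : ∀ a ∈ colors c, 2 ≤ #(colorClass c a) → IsFullStar (colorClass c a) m M) :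
    ∃ p, card (V p) = m ∧ IsStarColoring c p M := by
  let A : Set ℕ := {a | a ∈ colors c ∧ 2 ≤ #(colorClass c a)}
  obtain ⟨a₀, ha₀, hta₀⟩ := exists_two_le_ecount_colorClass hc fun _ ↦ Classical.arbitrary _
  have hA₀ : a₀ ∈ A := ⟨ha₀, hta₀.trans ecount_le_card⟩
  have hstar' : ∀ a ∈ A, IsFullStar (colorClass c a) m M := fun a ha ↦ hstar a ha.1 ha.2
  have : Nonempty (Σ i, V i) := ⟨(hstar' a₀ hA₀).choose⟩
  have : Nonempty ι := ⟨(hstar' a₀ hA₀).choose.1⟩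
  choose! y i j hij hyi hyj hm hM hmem using hstar'
  have htwo {a} (ha : a ∈ A) := two_le_ecount_iff_of_mem_iff (hij a ha) (hmem a ha)
  obtain ⟨p, hmaps, hinj, hsurj⟩ := exists_bijOn_of_existsUnique (A := A) (y := y) fun t ↦ by
    obtain ⟨a, ha, hta⟩ := exists_two_le_ecount_colorClass hc t
    have haA : a ∈ A := ⟨ha, hta.trans ecount_le_card⟩
    exact ⟨a, ⟨haA, (htwo haA t).1 hta⟩, fun b hb ↦
      hT.2 t b hb.1.1 a ha ((htwo hb.1 t).2 hb.2) hta⟩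
  have hp {a} (ha : a ∈ A) : (y a).1 = p := hmaps ha
  have hvertex : ∀ u : V p, ∃ a ∈ A, y a = ⟨p, u⟩ := fun u ↦ hsurj rfl
  choose a haA hya using hvertex
  have hclass (u : V p) (e : (completeMultipartiteGraph V).edgeSet) :
      (e : Sym2 _) ∈ fullStar ⟨p, u⟩ (i (a u)) (j (a u)) ↔ c e = a u := by
    rw [← hya, ← hmem _ (haA u), coe_mem_colorClass]
  refine ⟨p, hp hA₀ ▸ hm a₀ hA₀, fun u ↦ i (a u), fun u ↦ j (a u), fun u ↦
    ⟨hij _ (haA u), (hp (haA u)).symm.trans_ne (hyi _ (haA u)),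
      (hp (haA u)).symm.trans_ne (hyj _ (haA u)), hM _ (haA u)⟩, fun e f ↦ ?_⟩
  simp only [hclass]
  refine ⟨fun hef ↦ or_iff_not_imp_left.2 fun hne ↦ ?_, ?_⟩
  · have hceA : c e ∈ A := ⟨apply_mem_colors e, two_le_card_colorClass hef hne⟩
    obtain ⟨u, hu⟩ : ∃ u : V p, y (c e) = ⟨p, u⟩ := ⟨hp hceA ▸ (y (c e)).2, by grind⟩
    have hceu : c e = a u := hinj hceA (haA u) (hu.trans (hya u).symm)
    exact ⟨u, hceu, hef ▸ hceu⟩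
  · rintro (rfl | ⟨u, he, hf⟩)
    · rfl
    · rw [he, hf]

end StarColorings

section BookColorings

theorem isBookColoring_of_forall {m : ℕ} {d : (book m).EdgeLabeling ℕ}
    (htri : ∀ i, d.get .x (.z i) trivial = d.get .y (.z i) trivial ∨
      d.get .x (.z i) trivial = d.get .x .y trivial ∨
      d.get .y (.z i) trivial = d.get .x .y trivial)
    (hspine : ∀ i, d.get .x (.z i) trivial = d.get .x .y trivial →
      d.get .y (.z i) trivial ≠ d.get .x .y trivial)
    (hpage : ∀ b ≠ d.get .x .y trivial, ∀ i j,
      (d.get .x (.z i) trivial = b ∨ d.get .y (.z i) trivial = b) →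
      (d.get .x (.z j) trivial = b ∨ d.get .y (.z j) trivial = b) → i = j) :
    IsBookColoring d := by
  let a (i : Fin m) : ℕ := if d.get .x (.z i) trivial = d.get .x .y trivial then
    d.get .y (.z i) trivial else d.get .x (.z i) trivial
  have ha (i : Fin m) : a i ≠ d.get .x .y trivial := by grind
  have hor (i : Fin m) : d.get .x (.z i) trivial = a i ∨ d.get .y (.z i) trivial = a i := by grind
  refine ⟨d.get .x .y trivial, a, fun i j hij ↦ hpage _ (ha i) i j (hor i) (hij ▸ hor j), ha, rfl,
    fun i ↦ ?_⟩
  have := htri i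
  grind

/-- The vertices of `S` induce a book with `m` pages in `G` that carries a book coloring, and two
distinct edges of the same color lie in this book. -/
def IsBookColoringOn {W : Type} {G : SimpleGraph W} (c : G.EdgeLabeling ℕ) (S : Set W) (m : ℕ) :
    Prop :=
  ∃ φ : book m ↪g G, Set.range φ = S ∧ IsBookColoring (c.pullback φ.toHom) ∧
    ∀ e f : G.edgeSet, c e = c f →
      e = f ∨ ((∀ v ∈ (e : Sym2 _), v ∈ Set.range φ) ∧ ∀ v ∈ (f : Sym2 _), v ∈ Set.range φ)

variable {ι : Type} {V : ι → Type} {X Y : Σ i, V i} {r : ι} {m : ℕ}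

/-- The book with the spine `X Y` whose pages are the vertices of the partite set `r`. -/
def bookEmbedding (hXY : X.1 ≠ Y.1) (hrX : r ≠ X.1) (hrY : r ≠ Y.1) (σ : Fin m ≃ V r) :
    book m ↪g completeMultipartiteGraph V where
  toFun
    | .x => X
    | .y => Y
    | .z i => ⟨r, σ i⟩
  inj' := by
    rintro (_ | _ | i) (_ | _ | j) h <;> grind [σ.injective.eq_iff]
  map_rel_iff' := by
    rintro (_ | _ | i) (_ | _ | j) <;> refine completeMultipartiteGraph_adj_iff.trans ?_ <;>
      first
      | exact iff_of_false (fun h ↦ h rfl) id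
      | exact iff_of_true ‹_› trivial
      | exact iff_of_true (Ne.symm ‹_›) trivial

section UnitSpine

variable [∀ i, Fintype (V i)] (hX : card (V X.1) = 1) (hY : card (V Y.1) = 1)

include hX hY

theorem range_bookEmbedding (hXY : X.1 ≠ Y.1) (hrX : r ≠ X.1) (hrY : r ≠ Y.1) (σ : Fin m ≃ V r) :
    Set.range (bookEmbedding hXY hrX hrY σ) = {v | v.1 = X.1 ∨ v.1 = Y.1 ∨ v.1 = r} := by
  ext v
  constructor
  · rintro ⟨_ | _ | i, rfl⟩
    exacts [.inl rfl, .inr (.inl rfl), .inr (.inr rfl)]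
  · obtain ⟨j, x⟩ := v
    rintro (h | h | rfl)
    · exact ⟨.x, (eq_of_card_eq_one hX h).symm⟩
    · exact ⟨.y, (eq_of_card_eq_one hY h).symm⟩
    · exact ⟨.z (σ.symm x), Sigma.ext rfl (heq_of_eq (σ.apply_symm_apply x))⟩

variable [Fintype ι] {c : (completeMultipartiteGraph V).EdgeLabeling ℕ} {N : ℕ}
  [∀ i, Nonempty (V i)] (hc : ¬ HasRainbow c (completeGraph ι))

include hc

theorem exists_isBookClass_colorClass [DecidableEq ι] (hT : IsTight c N)
    (hclass : ∀ a ∈ colors c, 2 ≤ #(colorClass c a) →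
      ∃ r, r ≠ X.1 ∧ r ≠ Y.1 ∧ card (V r) = m ∧ IsBookClass X Y r (colorClass c a)) :
    ∃ r, r ≠ X.1 ∧ r ≠ Y.1 ∧ card (V r) = m ∧
      ∀ a ∈ colors c, 2 ≤ #(colorClass c a) → IsBookClass X Y r (colorClass c a) := by
  obtain ⟨a₀, ha₀, hta₀⟩ := exists_two_le_ecount_colorClass hc fun _ ↦ Classical.arbitrary _
  have h2a₀ := hta₀.trans ecount_le_card
  obtain ⟨r, hrX, hrY, hrm, hr⟩ := hclass a₀ ha₀ h2a₀
  refine ⟨r, hrX, hrY, hrm, fun a ha h2a ↦ ?_⟩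
  obtain ⟨r', -, -, -, hr'⟩ := hclass a ha h2a
  by_cases hrr' : r = r'
  · exact hrr' ▸ hr'
  · obtain ⟨x, hx⟩ := hr.exists_forall_two_le_ecount hX hY h2a₀
    obtain ⟨x', hx'⟩ := hr'.exists_forall_two_le_ecount hX hY h2a
    obtain ⟨t, ht, ht'⟩ := exists_transversal_of_ne (v := ⟨r, x⟩) (w := ⟨r', x'⟩) hrr'
    exact hT.2 t a ha a₀ ha₀ (hx' t ht') (hx t ht) ▸ hr

variable (hclass : ∀ a ∈ colors c, 2 ≤ #(colorClass c a) → IsBookClass X Y r (colorClass c a))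

include hclass

theorem exists_ne_mem_colorClass_of_isBookClass (x : V r) :
    ∃ a, ∃ e ∈ colorClass c a, ∃ f ∈ colorClass c a, e ≠ f ∧
      (e = s(X, Y) ∨ IsSpoke X Y ⟨r, x⟩ e) ∧ (f = s(X, Y) ∨ IsSpoke X Y ⟨r, x⟩ f) := by
  obtain ⟨t, ht⟩ := exists_apply_eq ⟨r, x⟩
  obtain ⟨a, ha, hta⟩ := exists_two_le_ecount_colorClass hc t
  obtain ⟨e, he, f, hf, hef, hte, htf⟩ := two_le_ecount.1 hta
  have hspoke : ∀ g ∈ colorClass c a, Spans t g → g = s(X, Y) ∨ IsSpoke X Y ⟨r, x⟩ g := by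
    refine fun g hg htg ↦ ((hclass a ha (hta.trans ecount_le_card)).1 g hg).imp_right ?_
    rintro ⟨y, hy⟩
    obtain rfl : y = x := ((hy.spans_iff hX hY).1 htg).symm.trans ht
    exact hy
  exact ⟨a, e, he, f, hf, hef, hspoke e he hte, hspoke f hf htf⟩

theorem isBookColoring_pullback_bookEmbedding (hXY : X.1 ≠ Y.1) (hrX : r ≠ X.1) (hrY : r ≠ Y.1)
    (σ : Fin m ≃ V r) :
    IsBookColoring (c.pullback (bookEmbedding hXY hrX hrY σ).toHom) := by
  set d := c.pullback (bookEmbedding hXY hrX hrY σ).toHom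
  have hspine (a : ℕ) : d.get .x .y trivial = a ↔ s(X, Y) ∈ colorClass c a :=
    (coe_mem_colorClass (e := ⟨s(X, Y), _⟩)).symm
  have hx (i : Fin m) (a : ℕ) : d.get .x (.z i) trivial = a ↔ s(X, ⟨r, σ i⟩) ∈ colorClass c a :=
    (coe_mem_colorClass (e := ⟨s(X, ⟨r, σ i⟩), _⟩)).symm
  have hy (i : Fin m) (a : ℕ) : d.get .y (.z i) trivial = a ↔ s(Y, ⟨r, σ i⟩) ∈ colorClass c a :=
    (coe_mem_colorClass (e := ⟨s(Y, ⟨r, σ i⟩), _⟩)).symm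
  have hbook {e f : Sym2 (Σ i, V i)} {a : ℕ} (he : e ∈ colorClass c a) (hf : f ∈ colorClass c a)
      (hef : e ≠ f) : IsBookClass X Y r (colorClass c a) :=
    have ⟨_, ha⟩ := mem_colorClass.1 he
    hclass a (mem_colors.2 ⟨_, ha⟩) (one_lt_card.2 ⟨e, he, f, hf, hef⟩)
  have hxy := (hspine _).1 rfl
  refine isBookColoring_of_forall (fun i ↦ ?_) (fun i hix hiy ↦ ?_) fun a ha i j hi hj ↦ ?_
  · obtain ⟨a, e, he, f, hf, hef, rfl | rfl | rfl, rfl | rfl | rfl⟩ :=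
      exists_ne_mem_colorClass_of_isBookClass hX hY hc hclass (σ i) <;>
    grind
  · rw [hx] at hix
    rw [hy] at hiy
    exact (hbook hxy hix (by grind)).notMem_of_mem hrX hrY hxy hix hiy
  · have hspoke {i : Fin m} (hi : d.get .x (.z i) trivial = a ∨ d.get .y (.z i) trivial = a) :
        ∃ e ∈ colorClass c a, IsSpoke X Y ⟨r, σ i⟩ e :=
      hi.elim (fun h ↦ ⟨_, (hx i a).1 h, .inl rfl⟩) fun h ↦ ⟨_, (hy i a).1 h, .inr rfl⟩
    obtain ⟨e, he, hei⟩ := hspoke hi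
    obtain ⟨f, hf, hfj⟩ := hspoke hj
    apply σ.injective
    by_cases hef : e = f
    · exact eq_of_heq (Sigma.mk.inj (hei.eq (hef ▸ hfj) hrX hrY)).2
    · exact (hbook he hf hef).eq_of_isSpoke hrX hrY (fun h ↦ ha ((hspine a).2 h).symm) he hf hei hfj

omit hclass in
theorem exists_isBookColoringOn [DecidableEq ι] (hXY : X.1 ≠ Y.1) (hT : IsTight c N)
    (hclass : ∀ a ∈ colors c, 2 ≤ #(colorClass c a) →
      ∃ r, r ≠ X.1 ∧ r ≠ Y.1 ∧ card (V r) = m ∧ IsBookClass X Y r (colorClass c a)) :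
    ∃ r, r ≠ X.1 ∧ r ≠ Y.1 ∧ card (V r) = m ∧
      IsBookColoringOn c {v | v.1 = X.1 ∨ v.1 = Y.1 ∨ v.1 = r} m := by
  obtain ⟨r, hrX, hrY, hrm, hr⟩ := exists_isBookClass_colorClass hX hY hc hT hclass
  have hrange := range_bookEmbedding hX hY hXY hrX hrY (Fintype.equivFinOfCardEq hrm).symm
  refine ⟨r, hrX, hrY, hrm, _, hrange,
    isBookColoring_pullback_bookEmbedding hX hY hc hr hXY hrX hrY _, fun e f hef ↦ ?_⟩
  rw [hrange]
  by_contra! hne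
  have hF := (hr _ (apply_mem_colors e) (two_le_card_colorClass hef hne.1)).1
  have hmem (g : (completeMultipartiteGraph V).edgeSet) (hg : c g = c e) :
      ∀ v ∈ (g : Sym2 (Σ i, V i)), v.1 = X.1 ∨ v.1 = Y.1 ∨ v.1 = r := by
    rcases hF g (coe_mem_colorClass.2 hg) with h | ⟨x, h | h⟩ <;> simp [h]
  obtain ⟨v, hv, hvS⟩ := hne.2 (hmem e rfl)
  exact hvS (hmem f hef.symm v hv)

end UnitSpine

end BookColorings

section Transport

variable {W₁ W₂ : Type} {G₁ : SimpleGraph W₁} {G₂ : SimpleGraph W₂} {c : G₁.EdgeLabeling ℕ}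

theorem pullback_symm_mapEdgeSet (c : G₁.EdgeLabeling ℕ) (ρ : G₁ ≃g G₂) (e : G₁.edgeSet) :
    c.pullback ρ.symm.toHom (ρ.mapEdgeSet e) = c e :=
  congrArg c (ρ.mapEdgeSet.symm_apply_apply e)

theorem coloredIso_pullback_symm (c : G₁.EdgeLabeling ℕ) (ρ : G₁ ≃g G₂) :
    ColoredIso c (c.pullback ρ.symm.toHom) := by
  have hrange : Set.range c = Set.range (c.pullback ρ.symm.toHom) :=
    (ρ.mapEdgeSet.symm.surjective.range_comp c).symm
  exact ⟨ρ, Equiv.setCongr hrange, fun e ↦ (pullback_symm_mapEdgeSet c ρ e).symm⟩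

theorem IsBookColoringOn.pullback_symm {S : Set W₁} {m : ℕ} (h : IsBookColoringOn c S m)
    (ρ : G₁ ≃g G₂) : IsBookColoringOn (c.pullback ρ.symm.toHom) (ρ '' S) m := by
  obtain ⟨φ, rfl, hφ, hc⟩ := h
  have hd : (c.pullback ρ.symm.toHom).pullback (ρ.toEmbedding.comp φ).toHom = c.pullback φ.toHom :=
    funext fun e ↦ (congrArg (c.pullback ρ.symm.toHom)
      (Subtype.ext (Sym2.map_map (g := ρ) (f := φ) (e : Sym2 _)).symm)).trans
        (pullback_symm_mapEdgeSet c ρ (φ.mapEdgeSet e))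
  refine ⟨ρ.toEmbedding.comp φ, Set.range_comp ρ φ, hd ▸ hφ, ?_⟩
  simp only [ρ.mapEdgeSet.surjective.forall, pullback_symm_mapEdgeSet,
    ρ.mapEdgeSet.injective.eq_iff]
  have hrange (e : G₁.edgeSet) (he : ∀ v ∈ (e : Sym2 W₁), v ∈ Set.range φ) :
      ∀ v ∈ (ρ.mapEdgeSet e : Sym2 W₂), v ∈ Set.range (ρ.toEmbedding.comp φ) := by
    intro v hv
    obtain ⟨w, hw, rfl⟩ := Sym2.mem_map.1 hv
    exact (he w hw).imp fun _ ↦ congrArg ρ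
  exact fun e f hef ↦ (hc e f hef).imp_right (And.imp (hrange e) (hrange f))

/-- The only two distinct edges of the same color are `e₀` and `f₀`. -/
def IsPairColoring {W : Type} {G : SimpleGraph W} (c : G.EdgeLabeling ℕ) (e₀ f₀ : Sym2 W) : Prop :=
  ∀ e f : G.edgeSet, c e = c f ↔ e = f ∨ ((e : Sym2 W) = e₀ ∧ (f : Sym2 W) = f₀) ∨
    ((f : Sym2 W) = e₀ ∧ (e : Sym2 W) = f₀)

theorem IsPairColoring.pullback_symm {e₀ f₀ : Sym2 W₁} (h : IsPairColoring c e₀ f₀)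
    (ρ : G₁ ≃g G₂) : IsPairColoring (c.pullback ρ.symm.toHom) (e₀.map ρ) (f₀.map ρ) := by
  have hmap (e : G₁.edgeSet) (e₀ : Sym2 W₁) :
      (ρ.mapEdgeSet e : Sym2 W₂) = e₀.map ρ ↔ (e : Sym2 W₁) = e₀ :=
    (Sym2.map.injective ρ.injective).eq_iff
  simpa only [IsPairColoring, ρ.mapEdgeSet.surjective.forall, pullback_symm_mapEdgeSet,
    ρ.mapEdgeSet.injective.eq_iff, hmap] using h

variable {k : ℕ} {n : Fin k → ℕ}

/-- The automorphism of a complete multipartite graph that permutes partite sets of equal sizes. -/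
def permIso (π : Equiv.Perm (Fin k)) (hπ : ∀ i, n (π i) = n i) :
    multipartite n ≃g multipartite n where
  toEquiv := Equiv.sigmaCongr π fun i ↦ finCongr (hπ i).symm
  map_rel_iff' := by
    simp only [completeMultipartiteGraph_adj_iff]
    exact π.injective.ne_iff

theorem map_permIso_mem_fullStar (π : Equiv.Perm (Fin k)) (hπ : ∀ i, n (π i) = n i)
    {y : Σ i, Fin (n i)} {i j : Fin k} {e : Sym2 (Σ i, Fin (n i))} :
    e.map (permIso π hπ) ∈ fullStar (permIso π hπ y) (π i) (π j) ↔ e ∈ fullStar y i j := by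
  have hfst (w : Σ i, Fin (n i)) (i : Fin k) : (permIso π hπ w).1 = π i ↔ w.1 = i :=
    π.injective.eq_iff
  have hedge (w : Σ i, Fin (n i)) :
      e.map (permIso π hπ) = s(permIso π hπ y, permIso π hπ w) ↔ e = s(y, w) :=
    (Sym2.map.injective (permIso π hπ).injective).eq_iff (b := s(y, w))
  refine (permIso π hπ).surjective.exists.trans (exists_congr fun w ↦ ?_)
  rw [hfst, hfst, hedge]

theorem IsStarColoring.pullback_permIso_symm {p : Fin k} {M : ℕ}
    {c : (multipartite n).EdgeLabeling ℕ} (h : IsStarColoring c p M) (π : Equiv.Perm (Fin k))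
    (hπ : ∀ i, n (π i) = n i) :
    IsStarColoring (c.pullback (permIso π hπ).symm.toHom) (π p) M := by
  obtain ⟨i, j, hij, hc⟩ := h
  refine ⟨fun u ↦ π (i (finCongr (hπ p) u)), fun u ↦ π (j (finCongr (hπ p) u)), fun u ↦ ?_, ?_⟩
  · simpa [hπ] using hij (finCongr (hπ p) u)
  · have hmap (e : (multipartite n).edgeSet) (u : Fin (n (π p))) :
        ((permIso π hπ).mapEdgeSet e : Sym2 (Σ i, Fin (n i))) ∈
          fullStar ⟨π p, u⟩ (π (i (finCongr (hπ p) u))) (π (j (finCongr (hπ p) u))) ↔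
        (e : Sym2 (Σ i, Fin (n i))) ∈ fullStar ⟨p, finCongr (hπ p) u⟩
          (i (finCongr (hπ p) u)) (j (finCongr (hπ p) u)) :=
      map_permIso_mem_fullStar π hπ (y := ⟨p, finCongr (hπ p) u⟩)
    rw [(permIso π hπ).mapEdgeSet.surjective.forall₂]
    intro e f
    simp only [pullback_symm_mapEdgeSet, (permIso π hπ).mapEdgeSet.injective.eq_iff, hmap, hc]
    exact or_congr_right (finCongr (hπ p)).surjective.exists

end Transport

section NormalForms

variable {k : ℕ} {n : Fin k → ℕ} {c : (multipartite n).EdgeLabeling ℕ}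

theorem fromEnd_ne {i j : ℕ} (hi : i < k) (hj : j < k) (h : i ≠ j) :
    (fromEnd i hi : Fin k) ≠ fromEnd j hj :=
  Fin.rev_injective.ne fun h' ↦ h (congrArg Fin.val h')

theorem apply_fromEnd_le (hn : Antitone n) {i j : ℕ} (hi : i < k) (hj : j < k) (h : i ≤ j) :
    n (fromEnd i hi) ≤ n (fromEnd j hj) :=
  hn (Fin.rev_le_rev.2 h)

theorem lt_fromEnd_zero (hk : 0 < k) {i : Fin k} (h : i ≠ fromEnd 0 hk) : i < fromEnd 0 hk := by
  simp only [fromEnd, Fin.lt_def, Fin.ne_iff_vne, Fin.val_rev] at h ⊢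
  omega

theorem fullStar_comm {ι : Type*} {V : ι → Type*} (y : Σ i, V i) (i j : ι) :
    fullStar y i j = fullStar y j i := by
  simp only [fullStar, or_comm]

theorem edgesTo_min_max (y : Σ i, Fin (n i)) (i j : Fin k) :
    edgesTo y (min i j) (max i j) = fullStar y i j := by
  rcases le_total i j with h | h
  · rw [min_eq_left h, max_eq_right h]
    rfl
  · rw [min_eq_right h, max_eq_left h, fullStar_comm]
    rfl

theorem IsStarColoring.isType3 (hk : 3 ≤ k)
    (h : IsStarColoring c (fromEnd 0 (by omega))
      (n (fromEnd 2 (by omega)) + n (fromEnd 1 (by omega)))) : IsType3 hk c := by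
  obtain ⟨i, j, hij, hc⟩ := h
  refine ⟨fun u ↦ min (i u) (j u), fun u ↦ max (i u) (j u), fun u ↦ ?_, fun e f ↦ ?_⟩
  · obtain ⟨hne, hi, hj, hsum⟩ := hij u
    refine ⟨inf_lt_sup.2 hne, max_lt (lt_fromEnd_zero _ hi.symm) (lt_fromEnd_zero _ hj.symm), ?_⟩
    simp only [Fintype.card_fin] at hsum
    grind
  · simp only [hc, edgesTo_min_max]

theorem exists_isType3 (hk : 3 ≤ k) {p : Fin k} (hp : n p = n (fromEnd 0 (by omega)))
    (h : IsStarColoring c p (n (fromEnd 2 (by omega)) + n (fromEnd 1 (by omega)))) :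
    ∃ c' : (multipartite n).EdgeLabeling ℕ, ColoredIso c c' ∧ IsType3 hk c' := by
  have hκ := h.pullback_permIso_symm (Equiv.swap p (fromEnd 0 (by omega)))
    (Equiv.apply_swap_eq_self hp)
  rw [Equiv.swap_apply_left] at hκ
  exact ⟨_, coloredIso_pullback_symm c _, hκ.isType3 hk⟩

theorem exists_isType2 (hk : 3 ≤ k) (h1 : n (fromEnd 1 (by omega)) = 1) {r : Fin k}
    (hr0 : r ≠ fromEnd 0 (by omega)) (hr1 : r ≠ fromEnd 1 (by omega))
    (hr : n r = n (fromEnd 2 (by omega)))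
    (h : IsBookColoringOn c
      {v | v.1 = fromEnd 0 (by omega) ∨ v.1 = fromEnd 1 (by omega) ∨ v.1 = r}
      (n (fromEnd 2 (by omega)))) :
    ∃ c' : (multipartite n).EdgeLabeling ℕ, ColoredIso c c' ∧ IsType2 hk c' := by
  let ρ := permIso (Equiv.swap r (fromEnd 2 (by omega))) (Equiv.apply_swap_eq_self hr)
  refine ⟨_, coloredIso_pullback_symm c ρ, h1, ?_⟩
  have hbook := h.pullback_symm ρ
  have hpre : {v : Σ i, Fin (n i) | v.1 = fromEnd 0 (by omega) ∨ v.1 = fromEnd 1 (by omega) ∨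
      v.1 = r} = ρ ⁻¹' lastThree hk := by
    ext v
    have h20 : (fromEnd 2 (by omega) : Fin k) ≠ fromEnd 0 (by omega) := fromEnd_ne _ _ (by omega)
    have h21 : (fromEnd 2 (by omega) : Fin k) ≠ fromEnd 1 (by omega) := fromEnd_ne _ _ (by omega)
    change _ ↔ Equiv.swap r _ v.1 = _ ∨ Equiv.swap r _ v.1 = _ ∨ Equiv.swap r _ v.1 = _
    simp only [Equiv.swap_apply_eq_iff, Equiv.swap_apply_right,
      Equiv.swap_apply_of_ne_of_ne hr0.symm h20.symm,
      Equiv.swap_apply_of_ne_of_ne hr1.symm h21.symm]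
    grind
  rwa [hpre, Set.image_preimage_eq _ ρ.surjective] at hbook

theorem exists_perm_apply_eq {α β γ : Type*} [Finite α] {s : β → γ} {m : γ} {f g : α → β}
    (hf : Function.Injective f) (hg : Function.Injective g) (hfm : ∀ x, s (f x) = m)
    (hgm : ∀ x, s (g x) = m) :
    ∃ π : Equiv.Perm β, (∀ i, s (π i) = s i) ∧ ∀ x, π (f x) = g x := by
  classical
  obtain ⟨σ, hσ⟩ := Equiv.Perm.exists_extending_pair
    (fun x ↦ (⟨f x, hfm x⟩ : {i // s i = m})) (fun x ↦ ⟨g x, hgm x⟩)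
    (fun x y h ↦ hf (congrArg Subtype.val h)) (fun x y h ↦ hg (congrArg Subtype.val h))
  refine ⟨Equiv.Perm.ofSubtype σ, fun i ↦ ?_, fun x ↦ ?_⟩
  · by_cases hi : s i = m
    · rw [Equiv.Perm.ofSubtype_apply_of_mem σ hi, hi]
      exact (σ ⟨i, hi⟩).2
    · rw [Equiv.Perm.ofSubtype_apply_of_not_mem σ hi]
  · rw [Equiv.Perm.ofSubtype_apply_of_mem σ (hfm x)]
    exact congrArg Subtype.val (hσ x)

theorem apply_fromEnd_eq_one (hn : Antitone n) (hpos : ∀ i, 0 < n i) {m : ℕ} (hm : m < k)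
    {f : Fin (m + 1) → Fin k} (hf : Function.Injective f) (hf1 : ∀ x, n (f x) = 1) :
    n (fromEnd m hm) = 1 := by
  by_contra hne
  have hmem : ∀ x, f x ∈ Ioi (fromEnd m hm) := by
    intro x
    by_contra hx
    have := hn (not_lt.1 (mt mem_Ioi.2 hx))
    grind
  have := card_le_card_of_injOn f (s := univ) (t := Ioi (fromEnd m hm)) (fun x _ ↦ hmem x) hf.injOn
  simp only [card_univ, Fintype.card_fin, fromEnd, Fin.card_Ioi, Fin.val_rev] at this
  omega

theorem exists_isType1 (hn : Antitone n) (hpos : ∀ i, 0 < n i) {v : Fin 4 → Σ i, Fin (n i)}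
    (hv : Function.Injective fun x ↦ (v x).1) (hv1 : ∀ x, n (v x).1 = 1)
    (hc : IsPairColoring c s(v 0, v 1) s(v 2, v 3)) :
    ∃ c' : (multipartite n).EdgeLabeling ℕ, ColoredIso c c' ∧ IsType1 hpos c' := by
  have hk : 4 ≤ k := by simpa using Fintype.card_le_of_injective _ hv
  have h3 := apply_fromEnd_eq_one hn hpos hk hv hv1
  let w (x : Fin 4) : Fin k := fromEnd (3 - x) (by omega)
  have hw : Function.Injective w := by
    intro x y h
    have h' := congrArg Fin.val (Fin.rev_injective h)
    grind
  have hw1 (x : Fin 4) : n (w x) = 1 :=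
    le_antisymm (h3 ▸ apply_fromEnd_le hn _ _ (by omega)) (hpos _)
  obtain ⟨π, hπ, hπv⟩ := exists_perm_apply_eq hv hw hv1 hw1
  have hmap (x : Fin 4) : permIso π hπ (v x) = firstVertex hpos (3 - x) (by omega) :=
    eq_of_card_eq_one ((Fintype.card_fin _).trans (hw1 x)) (hπv x)
  have h := hc.pullback_symm (permIso π hπ)
  simp only [Sym2.map_mk, hmap] at h
  exact ⟨_, coloredIso_pullback_symm c (permIso π hπ), hk, h3, h⟩

end NormalForms

section PairColorings

variable {ι : Type} {V : ι → Type} {c : (completeMultipartiteGraph V).EdgeLabeling ℕ}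
  {y v w : Σ i, V i} [∀ i, Fintype (V i)]

theorem IsPairColoring.isStarColoring (h : IsPairColoring c s(y, v) s(y, w))
    (hyv : y.1 ≠ v.1) (hyw : y.1 ≠ w.1) (hvw : v.1 ≠ w.1) (hy : card (V y.1) = 1)
    (hv : card (V v.1) = 1) (hw : card (V w.1) = 1) : IsStarColoring c y.1 2 := by
  refine ⟨fun _ ↦ v.1, fun _ ↦ w.1, fun _ ↦ ⟨hvw, hyv, hyw, by rw [hv, hw]⟩, fun e f ↦ ?_⟩
  have hstar (u : V y.1) (g : Sym2 (Σ i, V i)) :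
      g ∈ fullStar ⟨y.1, u⟩ v.1 w.1 ↔ g = s(y, v) ∨ g = s(y, w) := by
    rw [eq_of_card_eq_one hy (v := ⟨y.1, u⟩) rfl]
    constructor
    · rintro ⟨z, hz | hz, rfl⟩
      · exact .inl (by rw [eq_of_card_eq_one hv hz])
      · exact .inr (by rw [eq_of_card_eq_one hw hz])
    · rintro (rfl | rfl)
      · exact ⟨v, .inl rfl, rfl⟩
      · exact ⟨w, .inr rfl, rfl⟩
  have : Nonempty (V y.1) := ⟨y.2⟩
  simp only [h e f, hstar, exists_const, Subtype.ext_iff]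
  grind

variable [Fintype ι]

theorem isPairColoring_of_colorClass_eq {a : ℕ} {e₀ f₀ : Sym2 (Σ i, V i)}
    [DecidableEq (Sym2 (Σ i, V i))] (ha : colorClass c a = {e₀, f₀})
    (honly : ∀ b ∈ colors c, 2 ≤ #(colorClass c b) → b = a) : IsPairColoring c e₀ f₀ := by
  have hmem (g : (completeMultipartiteGraph V).edgeSet) :
      c g = a ↔ (g : Sym2 _) = e₀ ∨ (g : Sym2 _) = f₀ := by
    rw [← coe_mem_colorClass, ha, mem_insert, mem_singleton]
  intro e f
  constructor
  · refine fun h ↦ or_iff_not_imp_left.2 fun hne ↦ ?_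
    have hca := honly _ (apply_mem_colors e) (two_le_card_colorClass h hne)
    have he := (hmem e).1 hca
    have hf := (hmem f).1 (h ▸ hca)
    rw [Subtype.ext_iff] at hne
    grind
  · rintro (rfl | ⟨he, hf⟩ | ⟨hf, he⟩)
    · rfl
    · rw [(hmem e).2 (.inl he), (hmem f).2 (.inr hf)]
    · rw [(hmem e).2 (.inr he), (hmem f).2 (.inl hf)]

variable [DecidableEq ι]

theorem IsTight.eq_of_forall_two_le_ecount {N a b : ℕ} (hT : IsTight c N) (ha : a ∈ colors c)
    (hall : ∀ t, 2 ≤ ecount (colorClass c a) t) (hb : b ∈ colors c)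
    (hb2 : 2 ≤ #(colorClass c b)) : b = a := by
  by_contra hne
  have hprob : prob (fun t ↦ 2 ≤ ecount (colorClass c b) t) = 0 :=
    prob_eq_zero fun t ht ↦ hne (hT.2 t b hb a ha ht (hall t))
  have hcard := hT.1 b hb
  rw [hprob, mul_zero, eq_comm, sub_eq_zero, Nat.cast_eq_one] at hcard
  omega

theorem exists_isPairColoring [∀ i, Nonempty (V i)] (hc : ¬ HasRainbow c (completeGraph ι))
    (hT : IsTight c 1) :
    ∃ e ∈ (completeMultipartiteGraph V).edgeSet, ∃ f ∈ (completeMultipartiteGraph V).edgeSet,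
      e ≠ f ∧ (∀ v ∈ e, card (V v.1) = 1) ∧ (∀ v ∈ f, card (V v.1) = 1) ∧
      IsPairColoring c e f := by
  classical
  obtain ⟨a, ha, hat⟩ := exists_two_le_ecount_colorClass hc fun _ ↦ Classical.arbitrary _
  have hprob := hT.1 a ha
  rw [Nat.cast_one, one_mul] at hprob
  obtain ⟨h2, hspans⟩ := card_eq_two_of_prob_two_le_ecount_eq (hat.trans ecount_le_card) hprob
  obtain ⟨e, f, hef, hF⟩ := card_eq_two.1 h2
  have he : e ∈ colorClass c a := hF ▸ mem_insert_self _ _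
  have hf : f ∈ colorClass c a := hF ▸ mem_insert_of_mem (mem_singleton_self _)
  have hall (t : ∀ i, V i) : 2 ≤ ecount (colorClass c a) t :=
    two_le_ecount.2 ⟨e, he, f, hf, hef, hspans t e he, hspans t f hf⟩
  refine ⟨e, (mem_colorClass.1 he).1, f, (mem_colorClass.1 hf).1, hef,
    fun v ↦ card_eq_one_of_forall_spans fun t ↦ hspans t e he,
    fun v ↦ card_eq_one_of_forall_spans fun t ↦ hspans t f hf,
    isPairColoring_of_colorClass_eq hF fun b ↦ hT.eq_of_forall_two_le_ecount ha hall⟩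

end PairColorings

section Extremal

variable {k : ℕ} {n : Fin k → ℕ} {c : (multipartite n).EdgeLabeling ℕ}

theorem le_fromEnd_one (hk : 1 < k) {i : Fin k} (h0 : i ≠ fromEnd 0 (by omega)) :
    i ≤ fromEnd 1 hk := by
  simp only [fromEnd, Fin.le_def, Fin.ne_iff_vne, Fin.val_rev] at h0 ⊢
  omega

theorem le_fromEnd_two (hk : 2 < k) {i : Fin k} (h0 : i ≠ fromEnd 0 (by omega))
    (h1 : i ≠ fromEnd 1 (by omega)) : i ≤ fromEnd 2 hk := by
  simp only [fromEnd, Fin.le_def, Fin.ne_iff_vne, Fin.val_rev] at h0 h1 ⊢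
  omega

theorem sizesAtLeast_fromEnd (hn : Antitone n) (hk : 3 ≤ k)
    (F : Finset (Sym2 (Σ i, Fin (n i)))) :
    SizesAtLeast F (n (fromEnd 0 (by omega))) (n (fromEnd 1 (by omega)))
      (n (fromEnd 2 (by omega))) := by
  simp only [SizesAtLeast, LargeOff, Large, Fintype.card_fin]
  exact ⟨fun _ _ v _ ↦ hn (Fin.le_rev_iff.2 (Nat.zero_le _)), fromEnd 0 (by omega),
    fromEnd 1 (by omega), fun _ _ v _ h0 ↦ ⟨hn (le_fromEnd_one _ h0), fun h1 ↦
      hn (le_fromEnd_two _ h0 h1)⟩⟩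

theorem isTight_of_isExtremal (hn : Antitone n) (hpos : ∀ i, 0 < n i) (hk : 3 ≤ k)
    (hc : IsExtremal c (completeGraph (Fin k))) :
    IsTight c (n (fromEnd 0 (by omega)) *
      (n (fromEnd 2 (by omega)) + n (fromEnd 1 (by omega)) - 1)) := by
  have (i : Fin k) : Nonempty (Fin (n i)) := Fin.pos_iff_nonempty.1 (hpos i)
  have ha := hpos (fromEnd 2 (by omega))
  have hb := hpos (fromEnd 1 (by omega))
  have hN : 0 < n (fromEnd 2 (by omega)) + n (fromEnd 1 (by omega)) - 1 := by omega
  have hnum := card_edgeSet_le_of_isExtremal (κ := fromEnd 0 (by omega))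
    (i := fromEnd 2 (by omega)) (j := fromEnd 1 (by omega)) (fromEnd_ne _ _ (by omega))
    (fromEnd_ne _ _ (by omega)) (fromEnd_ne _ _ (by omega)) hc
  simp only [Fintype.card_fin] at hnum
  refine isTight_of_bound hc.1 (Nat.mul_pos (hpos _) hN) (fun a ha ↦ ?_) hnum
  rw [Nat.cast_mul, Nat.cast_pred (by omega), Nat.cast_add]
  exact prob_two_le_ecount_le (crossing_colorClass c a) (colorClass_nonempty ha)
    (sizesAtLeast_fromEnd hn hk _) hb (apply_fromEnd_le hn _ _ (by omega))
    (apply_fromEnd_le hn _ _ (by omega))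

theorem exists_isType3_of_two_le (hn : Antitone n) (hpos : ∀ i, 0 < n i) (hk : 3 ≤ k)
    (hc : IsExtremal c (completeGraph (Fin k))) (h1 : 2 ≤ n (fromEnd 1 (by omega))) :
    ∃ c' : (multipartite n).EdgeLabeling ℕ, ColoredIso c c' ∧ IsType3 hk c' := by
  have (i : Fin k) : Nonempty (Fin (n i)) := Fin.pos_iff_nonempty.1 (hpos i)
  have hT := isTight_of_isExtremal hn hpos hk hc
  obtain ⟨p, hp, h⟩ := exists_isStarColoring hc.1 hT fun a ha h2 ↦ by
    have heq := hT.1 a ha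
    rw [Nat.cast_mul, Nat.cast_pred (by omega), Nat.cast_add] at heq
    exact isFullStar_of_prob_two_le_ecount_eq (crossing_colorClass c a)
      (sizesAtLeast_fromEnd hn hk _) h1 (apply_fromEnd_le hn _ _ (by omega))
      (apply_fromEnd_le hn _ _ (by omega)) h2 heq
  exact exists_isType3 hk ((Fintype.card_fin _).symm.trans hp) h

theorem isTight_of_apply_fromEnd_one_eq_one (hn : Antitone n) (hpos : ∀ i, 0 < n i) (hk : 3 ≤ k)
    (hc : IsExtremal c (completeGraph (Fin k))) (h1 : n (fromEnd 1 (by omega)) = 1) :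
    IsTight c (n (fromEnd 2 (by omega))) := by
  have h0 : n (fromEnd 0 (by omega)) = 1 :=
    le_antisymm (h1 ▸ apply_fromEnd_le hn _ _ zero_le_one) (hpos _)
  simpa only [h0, h1, one_mul, Nat.add_sub_cancel] using isTight_of_isExtremal hn hpos hk hc

theorem exists_isType2_of_eq_one (hn : Antitone n) (hpos : ∀ i, 0 < n i) (hk : 3 ≤ k)
    (hc : IsExtremal c (completeGraph (Fin k))) (h1 : n (fromEnd 1 (by omega)) = 1)
    (h2 : 2 ≤ n (fromEnd 2 (by omega))) :
    ∃ c' : (multipartite n).EdgeLabeling ℕ, ColoredIso c c' ∧ IsType2 hk c' := by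
  have (i : Fin k) : Nonempty (Fin (n i)) := Fin.pos_iff_nonempty.1 (hpos i)
  have h0 : n (fromEnd 0 (by omega)) = 1 :=
    le_antisymm (h1 ▸ apply_fromEnd_le hn _ _ zero_le_one) (hpos _)
  have hT := isTight_of_apply_fromEnd_one_eq_one hn hpos hk hc h1
  have hX := (Fintype.card_fin _).trans h0
  have hY := (Fintype.card_fin _).trans h1
  obtain ⟨r, hr0, hr1, hr, h⟩ := exists_isBookColoringOn (X := firstVertex hpos 0 (by omega))
    (Y := firstVertex hpos 1 (by omega)) hX hY hc.1 (fromEnd_ne _ _ zero_ne_one) hT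
    fun a ha ha2 ↦ exists_isBookClass_of_prob_two_le_ecount_eq hX hY
      (fun i hi0 hi1 ↦ (hn (le_fromEnd_two _ hi0 hi1)).trans_eq (Fintype.card_fin _).symm) h2
      (crossing_colorClass c a) ha2 (hT.1 a ha)
  exact exists_isType2 hk h1 hr0 hr1 ((Fintype.card_fin _).symm.trans hr) h

variable {e f : Sym2 (Σ i, Fin (n i))}

theorem exists_isType1_of_disjoint (hn : Antitone n) (hpos : ∀ i, 0 < n i)
    (heG : e ∈ (multipartite n).edgeSet) (hfG : f ∈ (multipartite n).edgeSet)
    (h : IsPairColoring c e f) (he : ∀ v ∈ e, n v.1 = 1)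
    (hf : ∀ v ∈ f, n v.1 = 1) (hdisj : ∀ v ∈ e, v ∉ f) :
    ∃ c' : (multipartite n).EdgeLabeling ℕ, ColoredIso c c' ∧ IsType1 hpos c' := by
  have hne {v w : Σ i, Fin (n i)} (hv : v ∈ e) (hw : w ∈ f) : v.1 ≠ w.1 :=
    fun hvw ↦ hdisj v hv <| (eq_of_card_eq_one (V := fun i ↦ Fin (n i))
      ((Fintype.card_fin _).trans (hf w hw)) hvw).symm ▸ hw
  induction e with | _ v₀ v₁
  induction f with | _ v₂ v₃
  have h01 := completeMultipartiteGraph_adj_iff.1 heG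
  have h23 := completeMultipartiteGraph_adj_iff.1 hfG
  refine exists_isType1 (v := ![v₀, v₁, v₂, v₃]) hn hpos ?_ ?_ h
  · have h02 := hne (Sym2.mem_mk_left _ _) (Sym2.mem_mk_left _ _)
    have h03 := hne (Sym2.mem_mk_left _ _) (Sym2.mem_mk_right _ _)
    have h12 := hne (Sym2.mem_mk_right _ _) (Sym2.mem_mk_left _ _)
    have h13 := hne (Sym2.mem_mk_right _ _) (Sym2.mem_mk_right _ _)
    simp [Function.Injective, Fin.forall_fin_succ, h01, h01.symm, h23, h23.symm, h02, h02.symm,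
      h03, h03.symm, h12, h12.symm, h13, h13.symm]
  · simp [Fin.forall_fin_succ, he, hf]

theorem exists_isType3_of_common_vertex (hn : Antitone n) (hpos : ∀ i, 0 < n i) (hk : 3 ≤ k)
    (h2 : n (fromEnd 2 (by omega)) = 1)
    (heG : e ∈ (multipartite n).edgeSet) (hfG : f ∈ (multipartite n).edgeSet) (hef : e ≠ f)
    (h : IsPairColoring c e f) (he : ∀ v ∈ e, n v.1 = 1)
    (hf : ∀ v ∈ f, n v.1 = 1) {y : Σ i, Fin (n i)} (hye : y ∈ e)
    (hyf : y ∈ f) :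
    ∃ c' : (multipartite n).EdgeLabeling ℕ, ColoredIso c c' ∧ IsType3 hk c' := by
  have hunit {j : ℕ} (hj : j ≤ 2) : n (fromEnd j (by omega)) = 1 :=
    le_antisymm ((apply_fromEnd_le hn _ _ hj).trans_eq h2) (hpos _)
  obtain ⟨v, rfl⟩ := Sym2.mem_iff_exists.1 hye
  obtain ⟨w, rfl⟩ := Sym2.mem_iff_exists.1 hyf
  have hy := (Fintype.card_fin _).trans (he y (Sym2.mem_mk_left _ _))
  have hv := (Fintype.card_fin _).trans (he v (Sym2.mem_mk_right _ _))
  have hw := (Fintype.card_fin _).trans (hf w (Sym2.mem_mk_right _ _))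
  have hvw : v.1 ≠ w.1 := fun hvw ↦ hef (by simp only [eq_of_card_eq_one hw hvw])
  have hstar := h.isStarColoring (completeMultipartiteGraph_adj_iff.1 heG)
    (completeMultipartiteGraph_adj_iff.1 hfG) hvw hy hv hw
  refine exists_isType3 hk ((he y hye).trans (hunit zero_le_two).symm) ?_
  rwa [h2, hunit one_le_two]

theorem exists_isType1_or_isType3_of_eq_one (hn : Antitone n) (hpos : ∀ i, 0 < n i) (hk : 3 ≤ k)
    (hc : IsExtremal c (completeGraph (Fin k))) (h2 : n (fromEnd 2 (by omega)) = 1) :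
    ∃ c' : (multipartite n).EdgeLabeling ℕ,
      ColoredIso c c' ∧ (IsType1 hpos c' ∨ IsType3 hk c') := by
  have (i : Fin k) : Nonempty (Fin (n i)) := Fin.pos_iff_nonempty.1 (hpos i)
  have h1 : n (fromEnd 1 (by omega)) = 1 :=
    le_antisymm ((apply_fromEnd_le hn _ _ one_le_two).trans_eq h2) (hpos _)
  obtain ⟨e, heG, f, hfG, hef, he, hf, h⟩ := exists_isPairColoring hc.1
    (h2 ▸ isTight_of_apply_fromEnd_one_eq_one hn hpos hk hc h1)
  simp only [Fintype.card_fin] at he hf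
  by_cases hdisj : ∀ v ∈ e, v ∉ f
  · exact (exists_isType1_of_disjoint hn hpos heG hfG h he hf hdisj).imp fun _ ↦ And.imp_right .inl
  · push Not at hdisj
    obtain ⟨y, hye, hyf⟩ := hdisj
    exact (exists_isType3_of_common_vertex hn hpos hk h2 heG hfG hef h he hf hye hyf).imp
      fun _ ↦ And.imp_right .inr

end Extremal

end AntiRamsey

theorem mainTheorem4 (k : ℕ) (hk : 3 ≤ k) (n : Fin k → ℕ) (hn : Antitone n)
    (hpos : ∀ i, 0 < n i) (c : (AntiRamsey.multipartite n).EdgeLabeling ℕ)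
    (hc : AntiRamsey.IsExtremal c (SimpleGraph.completeGraph (Fin k))) :
    ∃ c' : (AntiRamsey.multipartite n).EdgeLabeling ℕ, AntiRamsey.ColoredIso c c' ∧
      (AntiRamsey.IsType1 hpos c' ∨ AntiRamsey.IsType2 hk c' ∨ AntiRamsey.IsType3 hk c') := by
  open AntiRamsey in
  rcases le_or_gt 2 (n (fromEnd 1 (by omega))) with hb | hb
  · obtain ⟨c', hiso, h3⟩ := exists_isType3_of_two_le hn hpos hk hc hb
    exact ⟨c', hiso, .inr (.inr h3)⟩
  have h1 : n (fromEnd 1 (by omega)) = 1 := le_antisymm (Nat.le_of_lt_succ hb) (hpos _)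
  rcases le_or_gt 2 (n (fromEnd 2 (by omega))) with ha | ha
  · obtain ⟨c', hiso, h2⟩ := exists_isType2_of_eq_one hn hpos hk hc h1 ha
    exact ⟨c', hiso, .inr (.inl h2)⟩
  · obtain ⟨c', hiso, h13⟩ := exists_isType1_or_isType3_of_eq_one hn hpos hk hc <|
      le_antisymm (Nat.le_of_lt_succ ha) (hpos _)
    exact ⟨c', hiso, h13.imp_right .inr⟩
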